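/- Let $d\ge 1$ and let $\mathbb Z^d$ carry its nearest-neighbour graph ($x\sim y$ iff $|x-y|=1$) with set of unoriented edges $\mathsf E$. Fix a weight $w:\mathbb Z^d\to(0,1]$ with $\sum_x w(x)<\infty$ and, for some $w_0>0$, $w(x)\le w_0w(y)$ whenever $x\sim y$. Let $q>1$ and $p=2q/(q-1)$. Put $$\mathcal S_p=\Big\{\sigma\in\mathbb R^{\mathbb Z^d}:\sum_x|\sigma(x)|^pw(x)<\infty\Big\},\qquad \|J\|_q=\Big(\sum_{\langle x,y\rangle\in\mathsf E}|J_{xy}|^q[w(x)+w(y)]\Big)^{1/q},\qquad \mathcal J_q=\{J\in\mathbb R^{\mathsf E}:\|J\|_q<\infty\},$$ where $\mathcal J_q$ carries the Borel $\sigma$-field of its norm topology. Let $\nu$ be a Borel probability measure on $\mathcal J_q$. Let $\chi=(\chi_x)_{x\in\mathbb Z^d}$ be probability measures on $\mathbb R$ with $\sup_x\int e^{\lambda|u|^p}\chi_x(du)<\infty$ and $\inf_x\int e^{-\lambda|u|^p}\chi_x(du)>0$ for every $\lambda>0$. For a finite non-empty $\Delta\subset\mathbb Z^d$, $J\in\mathcal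 J_q$ and $\xi\in\mathbb R^{\mathbb Z^d}$, let $\pi_\Delta(\cdot|J,\xi)$ be the probability measure on $\mathbb R^{\mathbb Z^d}$ given by $$\pi_\Delta(A|J,\xi)=\frac1{Z_\Delta(J,\xi)}\int_{\mathbb R^\Delta}\mathbb I_A(\sigma_\Delta\times\xi_{\Delta^c})\exp\Big(\sum_{\langle x,y\rangle\in\mathsf E;\;x,y\in\Delta}J_{xy}\sigma(x)\sigma(y)+\sum_{x\in\Delta,\,y\in\Delta^c,\,x\sim y}J_{xy}\sigma(x)\xi(y)\Big)\prod_{x\in\Delta}\chi_x(d\sigma(x)),$$ where $\sigma_\Delta\times\xi_{\Delta^c}$ equals $\sigma$ on $\Delta$ and $\xi$ on $\Delta^c$, and $Z_\Delta(J,\xi)$ is the normalizing factor. Let $\mathcal G_p(J)$ be the set of Borel probability measures $\mu$ on $\mathbb R^{\mathbb Z^d}$ (with the product topology) such that $\mu(\mathcal S_p)=1$ and $\int\pi_\Delta(A|J,\xi)\,\mu(d\xi)=\mu(A)$ for all Borel $A$ and all finite non-empty $\Delta\subset\mathbb Z^d$. Let $\mathcal P(\mathbb R^{\mathbb Z^d})$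 be the space of Borel probability measures on $\mathbb R^{\mathbb Z^d}$ with the weak topology. A random Gibbs measure is a Borel measurable map $\mu:\mathcal J_q\to\mathcal P(\mathbb R^{\mathbb Z^d})$ with $\mu(J)\in\mathcal G_p(J)$ for $\nu$-almost all $J$. A sequence $\mathcal D=\{\Delta_n\}_{n\in\mathbb N}$ of finite non-empty subsets of $\mathbb Z^d$ is called cofinal if it is strictly increasing with respect to inclusion and every $x\in\mathbb Z^d$ belongs to some $\Delta_n$. Theorem. For every $\xi\in\mathcal S_p$ there exist a random Gibbs measure $\mu^\xi$ and a cofinal sequence $\mathcal D=\{\Delta_n\}_{n\in\mathbb N}$ such that for $\nu$-almost all $J\in\mathcal J_q$ $$\mu^\xi(J)=\lim_{N\to\infty}\frac1N\sum_{n=1}^N\pi_{\Delta_n}(\cdot|J,\xi)\quad\text{in the weak topology of }\mathcal P(\mathbb R^{\mathbb Z^d}).$$ -/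

import Mathlib

open Filter Topology MeasureTheory
open scoped ENNReal

namespace RandomSpin

noncomputable section

/-! ### The lattice -/

/-- The points of the lattice `ℤ^d`. -/
abbrev Site (d : ℕ) : Type := Fin d → ℤ

/-- The nearest-neighbour graph of `ℤ^d`: `x ∼ y` iff `|x - y| = 1`. For integer vectors the
Euclidean length of `x - y` is `1` iff its `ℓ¹`-length is `1`. -/
def lattice (d : ℕ) : SimpleGraph (Site d) where
  Adj x y := ∑ i, |x i - y i| = 1
  symm := ⟨fun x y h => by simpa only [abs_sub_comm] using h⟩
  loopless := ⟨fun x h => by simp at h⟩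

/-- The (unoriented) edges of the lattice. -/
abbrev Edge (d : ℕ) : Type := ↥(lattice d).edgeSet

open Classical in
/-- The finite set of the neighbours of `x`. -/
def neighbors {d : ℕ} (x : Site d) : Finset (Site d) :=
  (Finset.Icc (x - 1) (x + 1)).filter (fun y => (lattice d).Adj x y)

theorem mem_neighbors {d : ℕ} {x y : Site d} : y ∈ neighbors x ↔ (lattice d).Adj x y := by
  classical
  simp only [neighbors, Finset.mem_filter, and_iff_right_iff_imp, Finset.mem_Icc]
  intro h
  have h1 : ∀ i, |x i - y i| ≤ 1 := fun i => by
    have h2 : ∑ i, |x i - y i| = 1 := h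
    rw [← h2]
    exact Finset.single_le_sum (f := fun i => |x i - y i|) (fun j _ => abs_nonneg _)
      (Finset.mem_univ i)
  constructor
  · intro i
    have := abs_le.1 (h1 i)
    simp only [Pi.sub_apply, Pi.one_apply]
    linarith [this.2]
  · intro i
    have := abs_le.1 (h1 i)
    simp only [Pi.add_apply, Pi.one_apply]
    linarith [this.1]

open Classical in
/-- The edges with both endpoints in the finite set `Δ`. -/
def edgesIn {d : ℕ} (Δ : Finset (Site d)) : Finset (Edge d) :=
  Δ.sym2.subtype (fun e => e ∈ (lattice d).edgeSet)

theorem mem_edgesIn {d : ℕ} {Δ : Finset (Site d)} {e : Edge d} :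
    e ∈ edgesIn Δ ↔ ∀ x ∈ (e : Sym2 (Site d)), x ∈ Δ := by
  classical
  simp [edgesIn, Finset.mem_subtype, Finset.mem_sym2_iff]

/-- A sequence of finite non-empty sets of sites is cofinal if it is increasing and exhausting. -/
structure IsCofinalSequence {d : ℕ} (D : ℕ → Finset (Site d)) : Prop where
  nonempty : ∀ n, (D n).Nonempty
  strictMono : StrictMono D
  exhausting : ∀ x, ∃ n, x ∈ D n

/-! ### Weights, tempered configurations, tempered interaction intensities -/

/-- The weight functions `w : ℤ^d → (0, 1]`. -/
structure Weight (d : ℕ) where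
  toFun : Site d → ℝ
  pos : ∀ x, 0 < toFun x
  le_one : ∀ x, toFun x ≤ 1
  summable : Summable toFun
  ratio : ∃ w₀ : ℝ, 0 < w₀ ∧ ∀ x y, (lattice d).Adj x y → toFun x ≤ w₀ * toFun y

instance {d : ℕ} : CoeFun (Weight d) (fun _ => Site d → ℝ) := ⟨Weight.toFun⟩

/-- The edge weight `w(x) + w(y)` of the edge `⟨x, y⟩`. -/
def Weight.edge {d : ℕ} (w : Weight d) (e : Edge d) : ℝ :=
  Sym2.lift ⟨fun x y => w x + w y, fun _ _ => add_comm _ _⟩ (e : Sym2 (Site d))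

theorem Weight.edge_pos {d : ℕ} (w : Weight d) (e : Edge d) : 0 < w.edge e := by
  obtain ⟨e, he⟩ := e
  induction e using Sym2.ind with
  | _ x y => exact add_pos (w.pos x) (w.pos y)

/-- Spin configurations, with the product topology and its Borel σ-field. -/
abbrev Config (d : ℕ) : Type := Site d → ℝ

/-- The space `𝒮_p` of tempered configurations: `∑_x |σ(x)|^p w(x) < ∞`. -/
def temperedConfigs {d : ℕ} (w : Weight d) (p : ℝ) : Set (Config d) :=
  {σ | Summable fun x => |σ x| ^ p * w x}

/-- The exponent `p = 2q / (q - 1)`. -/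
def spinExponent (q : ℝ) : ℝ := 2 * q / (q - 1)

section Interactions

variable {d : ℕ} (w : Weight d) (q : ℝ)

theorem edge_term_eq [hq : Fact (1 < q)] (J : Edge d → ℝ) (e : Edge d) :
    |J e| ^ q * w.edge e = (|J e| * w.edge e ^ (1 / q)) ^ q := by
  have h0 : (0 : ℝ) < q := lt_trans one_pos hq.out
  rw [Real.mul_rpow (abs_nonneg _) (Real.rpow_nonneg (w.edge_pos e).le _),
    ← Real.rpow_mul (w.edge_pos e).le, one_div_mul_cancel h0.ne', Real.rpow_one]

theorem edge_add [hq : Fact (1 < q)] (J K : Edge d → ℝ)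
    (hJ : Summable fun e => |J e| ^ q * w.edge e) (hK : Summable fun e => |K e| ^ q * w.edge e) :
    (Summable fun e => |J e + K e| ^ q * w.edge e) ∧
      (∑' e, |J e + K e| ^ q * w.edge e) ^ (1 / q) ≤
        (∑' e, |J e| ^ q * w.edge e) ^ (1 / q) + (∑' e, |K e| ^ q * w.edge e) ^ (1 / q) := by
  have h0 : (0 : ℝ) < q := lt_trans one_pos hq.out
  have hr : ∀ e : Edge d, 0 ≤ w.edge e ^ (1 / q) := fun e => Real.rpow_nonneg (w.edge_pos e).le _
  rw [tsum_congr (edge_term_eq w q J), tsum_congr (edge_term_eq w q K)]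
  rw [summable_congr (edge_term_eq w q J)] at hJ
  rw [summable_congr (edge_term_eq w q K)] at hK
  have hle : ∀ e, |J e + K e| ^ q * w.edge e ≤
      (|J e| * w.edge e ^ (1 / q) + |K e| * w.edge e ^ (1 / q)) ^ q := fun e => by
    have := edge_term_eq w q (fun e => J e + K e) e
    rw [this, ← add_mul]
    exact Real.rpow_le_rpow (mul_nonneg (abs_nonneg _) (hr e))
      (mul_le_mul_of_nonneg_right (abs_add_le _ _) (hr e)) h0.le
  have hnn : ∀ e, 0 ≤ |J e + K e| ^ q * w.edge e := fun e =>
    mul_nonneg (Real.rpow_nonneg (abs_nonneg _) _) (w.edge_pos e).le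
  obtain ⟨h1, h2⟩ := Real.Lp_add_le_tsum_of_nonneg hq.out.le
    (fun e => mul_nonneg (abs_nonneg (J e)) (hr e))
    (fun e => mul_nonneg (abs_nonneg (K e)) (hr e)) hJ hK
  have hs := Summable.of_nonneg_of_le hnn hle h1
  exact ⟨hs, le_trans (Real.rpow_le_rpow (tsum_nonneg hnn) (hs.tsum_le_tsum hle h1)
    (one_div_nonneg.2 h0.le)) h2⟩

/-- The tempered intensities as a subgroup of `ℝ^E`: `∑_{⟨x,y⟩} |J_{xy}|^q (w(x) + w(y)) < ∞`. -/
def temperedInteractions [hq : Fact (1 < q)] : AddSubgroup (Edge d → ℝ) where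
  carrier := {J | Summable fun e => |J e| ^ q * w.edge e}
  zero_mem' := by
    have h0 : q ≠ 0 := (lt_trans one_pos hq.out).ne'
    simp [Real.zero_rpow h0, summable_zero]
  add_mem' := fun {J K} hJ hK => (edge_add w q J K hJ hK).1
  neg_mem' := fun {J} hJ => by simpa using hJ

/-- The space `𝒥_q`. It is a type of its own, so that it carries the topology of its norm and
not the topology induced from the product space `ℝ^E`. -/
def Interaction [Fact (1 < q)] : Type := ↥(temperedInteractions w q)

variable {w q} in
/-- The family of intensities `(J_{xy})` underlying `J ∈ 𝒥_q`. -/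
def Interaction.val [Fact (1 < q)] (J : Interaction w q) : Edge d → ℝ := Subtype.val J

instance [Fact (1 < q)] : AddCommGroup (Interaction w q) :=
  inferInstanceAs (AddCommGroup ↥(temperedInteractions w q))

/-- The norm `‖J‖_q = (∑_{⟨x,y⟩} |J_{xy}|^q (w(x) + w(y)))^{1/q}`. -/
def interactionNorm [hq : Fact (1 < q)] : AddGroupNorm (Interaction w q) where
  toFun J := (∑' e, |J.val e| ^ q * w.edge e) ^ (1 / q)
  map_zero' := by
    have h0 : q ≠ 0 := (lt_trans one_pos hq.out).ne'
    have : ∀ e, (0 : Interaction w q).val e = 0 := fun e => rfl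
    simp [this, Real.zero_rpow h0, Real.zero_rpow (inv_ne_zero h0)]
  add_le' := fun J K => (edge_add w q J.val K.val J.2 K.2).2
  neg' := fun J => by
    have : ∀ e, (-J).val e = -J.val e := fun e => rfl
    simp [this]
  eq_zero_of_map_eq_zero' := fun J h => by
    have h0 : (0 : ℝ) < q := lt_trans one_pos hq.out
    have hnn : ∀ e, 0 ≤ |J.val e| ^ q * w.edge e := fun e =>
      mul_nonneg (Real.rpow_nonneg (abs_nonneg _) _) (w.edge_pos e).le
    have h1 : ∑' e, |J.val e| ^ q * w.edge e = 0 :=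
      (Real.rpow_eq_zero (tsum_nonneg hnn) (one_div_pos.2 h0).ne').1 h
    have hs : Summable fun e => |J.val e| ^ q * w.edge e := J.2
    refine Subtype.ext (funext fun e => ?_)
    have h2 : |J.val e| ^ q * w.edge e = 0 :=
      le_antisymm (h1 ▸ hs.le_tsum e fun j _ => hnn j) (hnn e)
    have h3 := (mul_eq_zero.1 h2).resolve_right (w.edge_pos e).ne'
    exact abs_eq_zero.1 ((Real.rpow_eq_zero (abs_nonneg _) h0.ne').1 h3)

instance [Fact (1 < q)] : NormedAddCommGroup (Interaction w q) :=
  (interactionNorm w q).toNormedAddCommGroup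

/-- `𝒥_q` carries the Borel σ-field of its norm topology. -/
instance [Fact (1 < q)] : MeasurableSpace (Interaction w q) := borel _

instance [Fact (1 < q)] : BorelSpace (Interaction w q) := ⟨rfl⟩

theorem norm_interaction [Fact (1 < q)] (J : Interaction w q) :
    ‖J‖ = (∑' e, |J.val e| ^ q * w.edge e) ^ (1 / q) := rfl

end Interactions

/-! ### The local Gibbs specification -/

/-- The class `𝒦_q` of families of single-spin measures. -/
structure SingleSpinClass {d : ℕ} (q : ℝ) (χ : Site d → ProbabilityMeasure ℝ) : Prop where
  upper : ∀ l : ℝ, 0 < l →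
    ⨆ x, ∫⁻ u, ENNReal.ofReal (Real.exp (l * |u| ^ spinExponent q)) ∂(χ x : Measure ℝ) < ∞
  lower : ∀ l : ℝ, 0 < l →
    0 < ⨅ x, ∫⁻ u, ENNReal.ofReal (Real.exp (-(l * |u| ^ spinExponent q))) ∂(χ x : Measure ℝ)

section Kernel

variable {d : ℕ}

open Classical in
/-- The configuration `σ_Δ × ξ_{Δᶜ}`: equal to `σ` in `Δ` and to `ξ` outside. -/
def glue (Δ : Finset (Site d)) (ξ : Config d) (σ : Δ → ℝ) : Config d :=
  fun x => if h : x ∈ Δ then σ ⟨x, h⟩ else ξ x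

/-- The product `σ(x) σ(y)` over the endpoints of the edge `⟨x, y⟩`. -/
def spinProduct (σ : Config d) (e : Edge d) : ℝ :=
  Sym2.lift ⟨fun x y => σ x * σ y, fun _ _ => mul_comm _ _⟩ (e : Sym2 (Site d))

open Classical in
/-- The intensity `J_{xy}` for `x ∼ y` (and `0` for sites that are not adjacent). -/
def coupling (J : Edge d → ℝ) (x y : Site d) : ℝ :=
  if h : (lattice d).Adj x y then J ⟨s(x, y), h⟩ else 0

open Classical in
/-- The negative interaction energy `-H_Δ(σ_Δ | J, ξ)`: the sum over the edges inside `Δ` plus the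
sum over the edges `⟨x, y⟩` with `x ∈ Δ`, `y ∉ Δ`. -/
def negEnergy (Δ : Finset (Site d)) (J : Edge d → ℝ) (ξ : Config d) (σ : Δ → ℝ) : ℝ :=
  ∑ e ∈ edgesIn Δ, J e * spinProduct (glue Δ ξ σ) e +
    ∑ x : Δ, ∑ y ∈ neighbors (x : Site d) \ Δ, coupling J x y * σ x * ξ y

/-- The product measure `χ_Δ` on `ℝ^Δ`. -/
def productSpin (χ : Site d → ProbabilityMeasure ℝ) (Δ : Finset (Site d)) : Measure (Δ → ℝ) :=
  Measure.pi fun x : Δ => (χ x : Measure ℝ)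

/-- The normalizing factor `Z_Δ(J, ξ)`. -/
def partitionFunction (χ : Site d → ProbabilityMeasure ℝ) (Δ : Finset (Site d))
    (J : Edge d → ℝ) (ξ : Config d) : ℝ≥0∞ :=
  ∫⁻ σ, ENNReal.ofReal (Real.exp (negEnergy Δ J ξ σ)) ∂productSpin χ Δ

/-- The local Gibbs kernel `π_Δ(· | J, ξ)` as a measure on the space of configurations. -/
def kernelMeasure (χ : Site d → ProbabilityMeasure ℝ) (Δ : Finset (Site d))
    (J : Edge d → ℝ) (ξ : Config d) : Measure (Config d) :=
  (partitionFunction χ Δ J ξ)⁻¹ •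
    ((productSpin χ Δ).withDensity
      fun σ => ENNReal.ofReal (Real.exp (negEnergy Δ J ξ σ))).map (glue Δ ξ)

theorem measurable_glue (Δ : Finset (Site d)) (ξ : Config d) : Measurable (glue Δ ξ) := by
  refine measurable_pi_lambda _ fun x => ?_
  by_cases h : x ∈ Δ
  · simpa [glue, h] using measurable_pi_apply _
  · simp [glue, h]

theorem measurable_spinProduct (e : Edge d) :
    Measurable fun σ : Config d => spinProduct σ e := by
  obtain ⟨e, he⟩ := e
  induction e using Sym2.ind with
  | _ x y => exact (measurable_pi_apply x).mul (measurable_pi_apply y)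

theorem measurable_negEnergy (Δ : Finset (Site d)) (J : Edge d → ℝ) (ξ : Config d) :
    Measurable (negEnergy Δ J ξ) := by
  unfold negEnergy
  refine Measurable.add (Finset.measurable_sum _ fun e _ => ?_)
    (Finset.measurable_sum _ fun x _ => Finset.measurable_sum _ fun y _ => ?_)
  · exact ((measurable_spinProduct e).comp (measurable_glue Δ ξ)).const_mul _
  · exact ((measurable_pi_apply x).const_mul _).mul_const _

/-- A function on `ℝ^Δ` dominated by a constant plus a multiple of `∑_x |σ(x)|^p`. -/
def Dominated (Δ : Finset (Site d)) (p : ℝ) (f : (Δ → ℝ) → ℝ) : Prop :=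
  ∃ C K : ℝ, 0 ≤ K ∧ ∀ σ, f σ ≤ C + K * ∑ x, |σ x| ^ p

theorem Dominated.add {Δ : Finset (Site d)} {p : ℝ} {f g : (Δ → ℝ) → ℝ}
    (hf : Dominated Δ p f) (hg : Dominated Δ p g) : Dominated Δ p fun σ => f σ + g σ := by
  obtain ⟨C, K, hK, h⟩ := hf
  obtain ⟨C', K', hK', h'⟩ := hg
  exact ⟨C + C', K + K', add_nonneg hK hK', fun σ => by linarith [h σ, h' σ]⟩

theorem Dominated.sum {ι : Type*} (s : Finset ι) {Δ : Finset (Site d)} {p : ℝ}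
    {f : ι → (Δ → ℝ) → ℝ} (hf : ∀ i ∈ s, Dominated Δ p (f i)) :
    Dominated Δ p fun σ => ∑ i ∈ s, f i σ := by
  classical
  induction s using Finset.induction_on with
  | empty => exact ⟨0, 0, le_rfl, fun σ => by simp⟩
  | insert a s ha ih =>
    simp only [Finset.sum_insert ha]
    exact (hf a (Finset.mem_insert_self a s)).add
      (ih fun i hi => hf i (Finset.mem_insert_of_mem hi))

theorem dominated_mul {Δ : Finset (Site d)} {p : ℝ} (hp : 2 ≤ p) (ξ : Config d) (c : ℝ)
    (x y : Site d) : Dominated Δ p fun σ => c * (glue Δ ξ σ x * glue Δ ξ σ y) := by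
  have hsq : ∀ u : ℝ, u ^ 2 ≤ 1 + |u| ^ p := fun u => by
    rcases le_total |u| 1 with h | h
    · have h1 : u ^ 2 ≤ 1 := by rw [← sq_abs]; exact pow_le_one₀ (abs_nonneg _) h
      linarith [Real.rpow_nonneg (abs_nonneg u) p]
    · have h1 : |u| ^ (2 : ℝ) ≤ |u| ^ p := Real.rpow_le_rpow_of_exponent_le h hp
      rw [Real.rpow_two, sq_abs] at h1
      linarith
  have hone : ∀ z : Site d, ∀ σ : Δ → ℝ,
      (glue Δ ξ σ z) ^ 2 ≤ 1 + |ξ z| ^ p + ∑ x, |σ x| ^ p := fun z σ => by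
    have hS : 0 ≤ ∑ x, |σ x| ^ p :=
      Finset.sum_nonneg fun x _ => Real.rpow_nonneg (abs_nonneg _) _
    have hX : 0 ≤ |ξ z| ^ p := Real.rpow_nonneg (abs_nonneg _) _
    by_cases h : z ∈ Δ
    · have h1 : glue Δ ξ σ z = σ ⟨z, h⟩ := by simp [glue, h]
      have h2 : |σ ⟨z, h⟩| ^ p ≤ ∑ x, |σ x| ^ p :=
        Finset.single_le_sum (f := fun x => |σ x| ^ p)
          (fun x _ => Real.rpow_nonneg (abs_nonneg _) _) (Finset.mem_univ _)
      rw [h1]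
      linarith [hsq (σ ⟨z, h⟩)]
    · have h1 : glue Δ ξ σ z = ξ z := by simp [glue, h]
      rw [h1]
      linarith [hsq (ξ z)]
  refine ⟨|c| * (1 + |ξ x| ^ p + |ξ y| ^ p), |c|, abs_nonneg _, fun σ => ?_⟩
  set a := glue Δ ξ σ x
  set b := glue Δ ξ σ y
  have h1 : c * (a * b) ≤ |c| * |a * b| := by rw [← abs_mul]; exact le_abs_self _
  have h2 : |a * b| ≤ (1 + |ξ x| ^ p + |ξ y| ^ p) + ∑ x, |σ x| ^ p := by
    have ha := hone x σ
    have hb := hone y σ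
    have hX : 0 ≤ |ξ x| ^ p := Real.rpow_nonneg (abs_nonneg _) _
    have hY : 0 ≤ |ξ y| ^ p := Real.rpow_nonneg (abs_nonneg _) _
    rw [abs_le]
    constructor <;> nlinarith [sq_nonneg (a + b), sq_nonneg (a - b)]
  calc c * (a * b) ≤ |c| * |a * b| := h1
    _ ≤ |c| * ((1 + |ξ x| ^ p + |ξ y| ^ p) + ∑ x, |σ x| ^ p) :=
        mul_le_mul_of_nonneg_left h2 (abs_nonneg _)
    _ = _ := by ring

theorem dominated_negEnergy {p : ℝ} (hp : 2 ≤ p) (Δ : Finset (Site d)) (J : Edge d → ℝ)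
    (ξ : Config d) : Dominated Δ p (negEnergy Δ J ξ) := by
  classical
  unfold negEnergy
  refine Dominated.add (Dominated.sum _ fun e _ => ?_)
    (Dominated.sum _ fun x _ => Dominated.sum _ fun y hy => ?_)
  · obtain ⟨e, he⟩ := e
    induction e using Sym2.ind with
    | _ x y => exact dominated_mul hp ξ _ x y
  · have h := dominated_mul (Δ := Δ) hp ξ (coupling J x y) x y
    have hy' : y ∉ Δ := (Finset.mem_sdiff.1 hy).2
    simpa [glue, hy', mul_assoc] using h

theorem two_le_spinExponent {q : ℝ} (hq : 1 < q) : 2 ≤ spinExponent q := by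
  unfold spinExponent
  rw [le_div_iff₀ (by linarith)]
  linarith

theorem partitionFunction_ne_top {q : ℝ} (hq : 1 < q) {χ : Site d → ProbabilityMeasure ℝ}
    (hχ : SingleSpinClass q χ) (Δ : Finset (Site d)) (J : Edge d → ℝ) (ξ : Config d) :
    partitionFunction χ Δ J ξ ≠ ∞ := by
  obtain ⟨C, K, hK, h⟩ := dominated_negEnergy (two_le_spinExponent hq) Δ J ξ
  set p := spinExponent q
  have hle : ∀ σ : Δ → ℝ, ENNReal.ofReal (Real.exp (negEnergy Δ J ξ σ)) ≤
      ENNReal.ofReal (Real.exp C) *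
        ∏ x, ENNReal.ofReal (Real.exp ((K + 1) * |σ x| ^ p)) := fun σ => by
    rw [← ENNReal.ofReal_prod_of_nonneg (fun _ _ => (Real.exp_pos _).le),
      ← ENNReal.ofReal_mul (Real.exp_pos _).le, ← Real.exp_sum, ← Real.exp_add,
      ← Finset.mul_sum]
    have hS : 0 ≤ ∑ x, |σ x| ^ p :=
      Finset.sum_nonneg fun x _ => Real.rpow_nonneg (abs_nonneg _) _
    exact ENNReal.ofReal_le_ofReal (Real.exp_le_exp.2 (by linarith [h σ]))
  have hm : Measurable fun u : ℝ => ENNReal.ofReal (Real.exp ((K + 1) * |u| ^ p)) := by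
    fun_prop
  refine ne_top_of_le_ne_top ?_ (lintegral_mono hle)
  have hm' : Measurable fun σ : Δ → ℝ =>
      ∏ x, ENNReal.ofReal (Real.exp ((K + 1) * |σ x| ^ p)) :=
    Finset.measurable_prod _ fun x _ => hm.comp (measurable_pi_apply x)
  rw [lintegral_const_mul _ hm']
  refine ENNReal.mul_ne_top ENNReal.ofReal_ne_top ?_
  unfold productSpin
  have hint : ∀ x : Δ,
      Integrable (fun u : ℝ => Real.exp ((K + 1) * |u| ^ p)) (χ x : Measure ℝ) := fun x => by
    refine ⟨Measurable.aestronglyMeasurable (by fun_prop), ?_⟩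
    rw [hasFiniteIntegral_iff_ofReal (ae_of_all _ fun u => (Real.exp_pos _).le)]
    refine lt_of_le_of_lt ?_ (hχ.upper (K + 1) (by linarith))
    exact le_iSup (fun x => ∫⁻ u, ENNReal.ofReal (Real.exp ((K + 1) * |u| ^ p))
      ∂(χ x : Measure ℝ)) (x : Site d)
  have h2 := (Integrable.fintype_prod hint).2
  rw [hasFiniteIntegral_iff_ofReal
    (ae_of_all _ fun σ => Finset.prod_nonneg fun x _ => (Real.exp_pos _).le)] at h2
  simpa only [ENNReal.ofReal_prod_of_nonneg (fun _ _ => (Real.exp_pos _).le)] using h2.ne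

theorem partitionFunction_ne_zero (χ : Site d → ProbabilityMeasure ℝ)
    (Δ : Finset (Site d)) (J : Edge d → ℝ) (ξ : Config d) :
    partitionFunction χ Δ J ξ ≠ 0 := by
  unfold partitionFunction productSpin
  rw [Ne, lintegral_eq_zero_iff (measurable_negEnergy Δ J ξ).exp.ennreal_ofReal]
  intro h
  obtain ⟨σ, hσ⟩ := h.exists
  simp only [Pi.zero_apply, ENNReal.ofReal_eq_zero] at hσ
  exact absurd hσ (not_le.2 (Real.exp_pos _))

theorem isProbabilityMeasure_kernelMeasure {q : ℝ} (hq : 1 < q)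
    {χ : Site d → ProbabilityMeasure ℝ} (hχ : SingleSpinClass q χ) (Δ : Finset (Site d))
    (J : Edge d → ℝ) (ξ : Config d) : IsProbabilityMeasure (kernelMeasure χ Δ J ξ) := by
  constructor
  rw [kernelMeasure, Measure.smul_apply, Measure.map_apply (measurable_glue Δ ξ) .univ,
    Set.preimage_univ, withDensity_apply _ .univ, setLIntegral_univ, smul_eq_mul]
  exact ENNReal.inv_mul_cancel (partitionFunction_ne_zero χ Δ J ξ)
    (partitionFunction_ne_top hq hχ Δ J ξ)

end Kernel

/-! ### Gibbs measures and averaged kernels -/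

section Gibbs

variable {d : ℕ} {w : Weight d} {q : ℝ} [hq : Fact (1 < q)] {χ : Site d → ProbabilityMeasure ℝ}

/-- The local Gibbs kernel `π_Δ(· | J, ξ)` as a probability measure. -/
def kernel (hχ : SingleSpinClass q χ) (Δ : Finset (Site d)) (J : Interaction w q)
    (ξ : Config d) : ProbabilityMeasure (Config d) :=
  ⟨kernelMeasure χ Δ J.val ξ, isProbabilityMeasure_kernelMeasure hq.out hχ Δ J.val ξ⟩

/-- The set `𝒢_p(J)` of tempered Gibbs measures: the tempered probability measures that solve the
Dobrushin-Lanford-Ruelle equation. -/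
def gibbsMeasures (hχ : SingleSpinClass q χ) (J : Interaction w q) :
    Set (ProbabilityMeasure (Config d)) :=
  {μ | (μ : Measure (Config d)) (temperedConfigs w (spinExponent q)) = 1 ∧
    ∀ Δ : Finset (Site d), Δ.Nonempty → ∀ A : Set (Config d), MeasurableSet A →
      ∫⁻ ξ, (kernel hχ Δ J ξ : Measure (Config d)) A ∂(μ : Measure (Config d)) =
        (μ : Measure (Config d)) A}

/-- Random Gibbs measures: maps `J ↦ μ(J)`, Borel measurable for the weak topology on the
probability measures, with `μ(J) ∈ 𝒢_p(J)` for `ν`-almost all `J`. -/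
def IsRandomGibbsMeasure (hχ : SingleSpinClass q χ) (ν : Measure (Interaction w q))
    (μ : Interaction w q → ProbabilityMeasure (Config d)) : Prop :=
  Measurable[_, borel (ProbabilityMeasure (Config d))] μ ∧
    ∀ᵐ J ∂ν, μ J ∈ gibbsMeasures hχ J

/-- The measure `N⁻¹ ∑_{n < N} m_n`. -/
def averageMeasure {Ω : Type*} [MeasurableSpace Ω] (m : ℕ → ProbabilityMeasure Ω) (N : ℕ) :
    Measure Ω :=
  (N : ℝ≥0∞)⁻¹ • ∑ n ∈ Finset.range N, (m n : Measure Ω)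

theorem isProbabilityMeasure_averageMeasure {Ω : Type*} [MeasurableSpace Ω]
    (m : ℕ → ProbabilityMeasure Ω) (N : ℕ+) : IsProbabilityMeasure (averageMeasure m N) := by
  constructor
  rw [averageMeasure, Measure.smul_apply, Measure.finsetSum_apply]
  simp only [measure_univ, Finset.sum_const, Finset.card_range, nsmul_eq_mul, mul_one, smul_eq_mul]
  exact ENNReal.inv_mul_cancel (by exact_mod_cast N.ne_zero) (ENNReal.natCast_ne_top _)

/-- The averaged kernel `π_{𝒟,N}(· | J, ξ)`: the average of the kernels of the first `N ≥ 1` sets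
of the sequence `𝒟` (whose numbering starts here with `0`). -/
def averagedKernel (hχ : SingleSpinClass q χ) (D : ℕ → Finset (Site d)) (N : ℕ+)
    (J : Interaction w q) (ξ : Config d) : ProbabilityMeasure (Config d) :=
  ⟨averageMeasure (fun n => kernel hχ (D n) J ξ) N, isProbabilityMeasure_averageMeasure _ N⟩

end Gibbs

end

end RandomSpin

open RandomSpin

/-! For a fixed `J` the kernels `π_Δ(· | J, ξ)` form a tight family, so limit points exist; but a
convergent subsequence of volumes would in general depend on `J`, and a choice made separately for
each `J` need not be measurable. Averaging over volumes removes this dependence, in the spirit of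
Komlós.

Integrating countably many separating functions `g k` with values in `[0, 1]` against the kernels
gives bounded random variables `X k n` on the probability space `(𝒥_q, ν)`. One subsequence of
volumes, chosen before `J`, makes the inner products of the `X k n` in `L²(ν)` almost constant off
the diagonal, for every `k`. The variance of the Cesàro means then decays like `1 / N`, which forces
almost sure convergence (`exists_strictMono_ae_tendsto_average`).

Tightness comes from a moment bound (`exists_tsum_moment_kernelMeasure_le`). Young's inequality with
the conjugate exponents `q` and `p / 2` controls the energy at one site by `p`-th powers of spins,
with an arbitrarily small coefficient at the neighbours. By consistency of the specification this
gives a linear inequality for the moments `∫ |σ(x)|^p dπ_Δ`, which closes after summation against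
`w`, uniformly in `Δ`. Tightness and the separating family turn convergence of the averages into
weak convergence (`exists_tendsto_averagedKernel`).

The averaged kernels are continuous in `J`, so the limit is Borel in `J` up to a null set. It
satisfies the equilibrium equation because `π_Δ` preserves bounded continuous functions and `π_Λ π_Δ
= π_Λ` for all large `Λ` of the sequence, while the finitely many other terms vanish in the average.
It is tempered because the weighted energy is lower semicontinuous. -/

/-! ### Almost sure convergence of Cesàro means along a subsequence -/

/-- A bounded family of symmetric arrays has a common subsequence along which the off-diagonal
entries converge exponentially fast in the smaller index. -/
theorem exists_strictMono_gram_close (G : ℕ → ℕ → ℕ → ℝ) (hG : ∀ k i j, G k i j ∈ Set.Icc (-1) 1) :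
    ∃ φ : ℕ → ℕ, StrictMono φ ∧ ∃ g : ℕ → ℝ, (∀ k, g k ∈ Set.Icc (-1) 1) ∧
      ∀ k i j, k ≤ i → i < j → |G k (φ i) (φ j) - g k| ≤ 2 * (1 / 2) ^ i := by
  have hpos : ∀ i : ℕ, (0 : ℝ) < (1 / 2) ^ i := fun i => by positivity
  -- For a Gram matrix, `a (k, i)` would be the inner product of the `i`-th vector with a weak
  -- limit. Tychonoff gives these row limits for all `k` and `i` at once.
  obtain ⟨a, ha, ψ, hψ, hlim⟩ :=
    (isCompact_univ_pi fun _ : ℕ × ℕ => isCompact_Icc (a := (-1 : ℝ)) (b := 1)).tendsto_subseq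
      (x := fun j p => G p.1 p.2 j) (fun j => fun p _ => hG _ _ _)
  -- Now the row index tends to infinity: `g k` plays the role of the squared norm of the weak
  -- limit.
  obtain ⟨g, hg, θ, hθ, hlim'⟩ :=
    (isCompact_univ_pi fun _ : ℕ => isCompact_Icc (a := (-1 : ℝ)) (b := 1)).tendsto_subseq
      (x := fun i k => a (k, ψ i)) (fun i => fun k _ => ha _ trivial)
  rw [tendsto_pi_nhds] at hlim hlim'
  obtain ⟨ρ, hρ, hclose⟩ : ∃ ρ : ℕ → ℕ, StrictMono ρ ∧
      ∀ i, ∀ k ∈ Set.Iic i, |a (k, ψ (θ (ρ i))) - g k| < (1 / 2) ^ i := by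
    refine extraction_forall_of_eventually' (P := fun i n => ∀ k ∈ Set.Iic i,
      |a (k, ψ (θ n)) - g k| < (1 / 2) ^ i) fun i => ?_
    have : ∀ᶠ n in atTop, ∀ k ∈ Set.Iic i, |a (k, ψ (θ n)) - g k| < (1 / 2) ^ i := by
      rw [eventually_all_finite (Set.finite_Iic i)]
      exact fun k _ => (Metric.tendsto_nhds.1 (hlim' k)) _ (hpos i)
    exact eventually_atTop.1 this
  have he : StrictMono fun i => ψ (θ (ρ i)) := hψ.comp (hθ.comp hρ)
  have hlim2 : ∀ k i, Tendsto (fun j => G k i (ψ (θ (ρ j)))) atTop (𝓝 (a (k, i))) := fun k i =>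
    (hlim (k, i)).comp ((hθ.comp hρ).tendsto_atTop)
  -- Each new index lies so far out that, in the rows of the finitely many indices already chosen,
  -- the entries have nearly reached their limits.
  obtain ⟨f, -, hf⟩ := exists_seq_of_forall_finset_exists (fun _ : ℕ => True)
    (fun x y => x < y ∧ ∀ k ∈ Set.Iic x,
      |G k (ψ (θ (ρ x))) (ψ (θ (ρ y))) - a (k, ψ (θ (ρ x)))| < (1 / 2) ^ x) (fun s _ => by
      have : ∀ᶠ y in atTop, ∀ x ∈ s, x < y ∧ ∀ k ∈ Set.Iic x,
          |G k (ψ (θ (ρ x))) (ψ (θ (ρ y))) - a (k, ψ (θ (ρ x)))| < (1 / 2) ^ x := by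
        rw [eventually_all_finset]
        refine fun x _ => (eventually_gt_atTop x).and ?_
        rw [eventually_all_finite (Set.finite_Iic x)]
        exact fun k _ => (Metric.tendsto_nhds.1 (hlim2 k _)) _ (hpos x)
      obtain ⟨y, hy⟩ := this.exists
      exact ⟨y, trivial, hy⟩)
  have hfm : StrictMono f := fun i j hij => (hf i j hij).1
  refine ⟨fun i => ψ (θ (ρ (f i))), he.comp hfm, g, fun k => hg k trivial, fun k i j hk hij => ?_⟩
  have hki : k ≤ f i := hk.trans (hfm.le_apply)
  have h1 := (hf i j hij).2 k hki
  have h2 := hclose (f i) k hki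
  have h3 : (1 / 2 : ℝ) ^ f i ≤ (1 / 2) ^ i :=
    pow_le_pow_of_le_one (by norm_num) (by norm_num) hfm.le_apply
  calc |G k (ψ (θ (ρ (f i)))) (ψ (θ (ρ (f j)))) - g k|
      ≤ |G k (ψ (θ (ρ (f i)))) (ψ (θ (ρ (f j)))) - a (k, ψ (θ (ρ (f i))))|
        + |a (k, ψ (θ (ρ (f i)))) - g k| := abs_sub_le _ _ _
    _ ≤ 2 * (1 / 2) ^ i := by linarith

/-- Off the diagonal the error is governed by the smaller index, hence by `C 2⁻ⁱ + C 2⁻ʲ`, whose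
double sum is at most `2CM + 2CN`; the diagonal adds at most `2N`. The total is linear in `M`,
against a main term of order `N M`. -/
theorem sum_sum_abs_gram_sub_le (G : ℕ → ℕ → ℝ) (g C : ℝ) (hC : 0 ≤ C)
    (hsymm : ∀ i j, G i j = G j i) (hdiag : ∀ i, |G i i - g| ≤ 2)
    (hoff : ∀ i j, i < j → |G i j - g| ≤ C * (1 / 2) ^ i) {N M : ℕ} (hNM : N ≤ M) :
    |∑ i ∈ Finset.range N, ∑ j ∈ Finset.range M, G i j - N * M * g| ≤ (2 + 4 * C) * M := by
  have hgeom : ∀ N : ℕ, ∑ i ∈ Finset.range N, (1 / 2 : ℝ) ^ i ≤ 2 := fun N => by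
    have := sum_geometric_two_le N
    exact this
  have hbd : ∀ i j, |G i j - g| ≤
      (if i = j then 2 else 0) + (C * (1 / 2) ^ i + C * (1 / 2) ^ j) := fun i j => by
    have hi : 0 ≤ C * (1 / 2) ^ i := by positivity
    have hj : 0 ≤ C * (1 / 2) ^ j := by positivity
    rcases lt_trichotomy i j with h | h | h
    · rw [if_neg h.ne]; linarith [hoff i j h]
    · subst h; rw [if_pos rfl]; linarith [hdiag i]
    · rw [if_neg h.ne', hsymm]; linarith [hoff j i h]
  have h1 : ∑ i ∈ Finset.range N, ∑ j ∈ Finset.range M, G i j - N * M * g =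
      ∑ i ∈ Finset.range N, ∑ j ∈ Finset.range M, (G i j - g) := by
    simp [Finset.sum_sub_distrib, mul_assoc]
  rw [h1]
  have hN : (N : ℝ) ≤ M := by exact_mod_cast hNM
  calc |∑ i ∈ Finset.range N, ∑ j ∈ Finset.range M, (G i j - g)|
      ≤ ∑ i ∈ Finset.range N, ∑ j ∈ Finset.range M, |G i j - g| :=
        (Finset.abs_sum_le_sum_abs _ _).trans
          (Finset.sum_le_sum fun i _ => Finset.abs_sum_le_sum_abs _ _)
    _ ≤ ∑ i ∈ Finset.range N, ∑ j ∈ Finset.range M,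
          ((if i = j then 2 else 0) + (C * (1 / 2) ^ i + C * (1 / 2) ^ j)) :=
        Finset.sum_le_sum fun i _ => Finset.sum_le_sum fun j _ => hbd i j
    _ ≤ ∑ i ∈ Finset.range N, (2 + (M * (C * (1 / 2) ^ i) + C * 2)) := by
        refine Finset.sum_le_sum fun i _ => ?_
        rw [Finset.sum_add_distrib, Finset.sum_add_distrib, Finset.sum_const,
          Finset.card_range, nsmul_eq_mul, ← Finset.mul_sum]
        refine add_le_add ?_ (add_le_add le_rfl (mul_le_mul_of_nonneg_left (hgeom M) hC))
        rw [Finset.sum_ite_eq]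
        split_ifs <;> norm_num
    _ = N * (2 + C * 2) + M * (C * ∑ i ∈ Finset.range N, (1 / 2) ^ i) := by
        rw [Finset.mul_sum, Finset.mul_sum, Finset.sum_add_distrib, Finset.sum_add_distrib]
        simp; ring
    _ ≤ M * (2 + C * 2) + M * (C * 2) := by
        have := hgeom N
        gcongr
    _ = _ := by ring

/-- The Cesàro means of bounded nonnegative functions whose Gram matrix is off the diagonal
exponentially close to a constant converge almost everywhere. -/
theorem ae_tendsto_average_of_gram_close {Ω : Type*} [MeasurableSpace Ω] (ν : Measure Ω)
    [IsProbabilityMeasure ν] (X : ℕ → Ω → ℝ) (hX : ∀ i, Measurable (X i))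
    (h01 : ∀ i ω, X i ω ∈ Set.Icc 0 1) (g C : ℝ) (hg : g ∈ Set.Icc (-1) 1) (hC : 0 ≤ C)
    (hoff : ∀ i j, i < j → |∫ ω, X i ω * X j ω ∂ν - g| ≤ C * (1 / 2) ^ i) :
    ∀ᵐ ω ∂ν, ∃ l, Tendsto (fun N : ℕ => (∑ i ∈ Finset.range N, X i ω) / N) atTop (𝓝 l) := by
  set S : ℕ → Ω → ℝ := fun N ω => ∑ i ∈ Finset.range N, X i ω with hS
  set K := 2 + 4 * C with hK
  have hK0 : 0 < K := by positivity
  have hint : ∀ i j, Integrable (fun ω => X i ω * X j ω) ν := fun i j => by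
    refine Integrable.of_bound ((hX i).mul (hX j)).aestronglyMeasurable 1
      (ae_of_all _ fun ω => ?_)
    obtain ⟨h1, h2⟩ := h01 i ω
    obtain ⟨h3, h4⟩ := h01 j ω
    rw [Real.norm_of_nonneg (mul_nonneg h1 h3)]
    exact mul_le_one₀ h2 h3 h4
  have hG01 : ∀ i j, ∫ ω, X i ω * X j ω ∂ν ∈ Set.Icc (0 : ℝ) 1 := fun i j => by
    refine ⟨integral_nonneg fun ω => mul_nonneg (h01 i ω).1 (h01 j ω).1, ?_⟩
    refine (integral_mono (hint i j) (integrable_const 1)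
      fun ω => mul_le_one₀ (h01 i ω).2 (h01 j ω).1 (h01 j ω).2).trans ?_
    simp
  have hSS : ∀ N M, ∫ ω, S N ω * S M ω ∂ν =
      ∑ i ∈ Finset.range N, ∑ j ∈ Finset.range M, ∫ ω, X i ω * X j ω ∂ν := fun N M => by
    simp only [hS, Finset.sum_mul_sum]
    rw [integral_finsetSum _ fun i _ => integrable_finsetSum _ fun j _ => hint i j]
    exact Finset.sum_congr rfl fun i _ => integral_finsetSum _ fun j _ => hint i j
  have hSint : ∀ N M, Integrable (fun ω => S N ω * S M ω) ν := fun N M => by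
    simp only [hS, Finset.sum_mul_sum]
    exact integrable_finsetSum _ fun i _ => integrable_finsetSum _ fun j _ => hint i j
  have hcov : ∀ N M, N ≤ M → |∫ ω, S N ω * S M ω ∂ν - N * M * g| ≤ K * M := fun N M h => by
    rw [hSS]
    refine sum_sum_abs_gram_sub_le _ g C hC (fun i j => by simp only [mul_comm]) (fun i => ?_)
      hoff h
    have := hG01 i i
    rw [abs_le]
    constructor <;> linarith [this.1, this.2, hg.1, hg.2]
  -- Expanding the square, the main terms cancel as `g - 2g + g`. The three errors, counted with
  -- multiplicities 1, 2, 1, are each at most `K / N`.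
  have hsq : ∀ N M : ℕ, 0 < N → N ≤ M →
      ∫ ω, (S N ω / N - S M ω / M) ^ 2 ∂ν ≤ 4 * K / N := fun N M hN hNM => by
    have hN' : (0 : ℝ) < N := by exact_mod_cast hN
    have hNM' : (N : ℝ) ≤ M := by exact_mod_cast hNM
    have hM' : (0 : ℝ) < M := hN'.trans_le hNM'
    have e1 : ∀ ω, (S N ω / N - S M ω / M) ^ 2 = (1 / (N : ℝ) ^ 2) * (S N ω * S N ω)
        - (2 / (N * M : ℝ)) * (S N ω * S M ω) + (1 / (M : ℝ) ^ 2) * (S M ω * S M ω) := fun ω => by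
      field_simp
      ring
    have e2 : Integrable (fun ω => (1 / (N : ℝ) ^ 2) * (S N ω * S N ω)
        - (2 / (N * M : ℝ)) * (S N ω * S M ω)) ν :=
      ((hSint N N).const_mul _).sub ((hSint N M).const_mul _)
    simp_rw [e1]
    rw [integral_add e2 ((hSint M M).const_mul _), integral_sub ((hSint N N).const_mul _)
      ((hSint N M).const_mul _), integral_const_mul, integral_const_mul, integral_const_mul]
    have hA := (abs_le.1 (hcov N N le_rfl)).2
    have hB := (abs_le.1 (hcov N M hNM)).1
    have hD := (abs_le.1 (hcov M M le_rfl)).2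
    have a1 : 1 / (N : ℝ) ^ 2 * ∫ ω, S N ω * S N ω ∂ν ≤ g + K / N := by
      rw [div_mul_eq_mul_div, one_mul, div_le_iff₀ (by positivity)]
      have : (g + K / N) * (N : ℝ) ^ 2 = N * N * g + K * N := by field_simp
      linarith
    have a2 : g - K / N ≤ 1 / (N * M : ℝ) * ∫ ω, S N ω * S M ω ∂ν := by
      rw [div_mul_eq_mul_div, one_mul, le_div_iff₀ (by positivity)]
      have : (g - K / N) * (N * M : ℝ) = N * M * g - K * M := by field_simp
      linarith
    have a3 : 1 / (M : ℝ) ^ 2 * ∫ ω, S M ω * S M ω ∂ν ≤ g + K / N := by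
      have h4 : K / M ≤ K / N := by gcongr
      refine le_trans ?_ (add_le_add_right h4 g)
      rw [div_mul_eq_mul_div, one_mul, div_le_iff₀ (by positivity)]
      have : (g + K / M) * (M : ℝ) ^ 2 = M * M * g + K * M := by field_simp
      linarith
    have a4 : 2 / (N * M : ℝ) * ∫ ω, S N ω * S M ω ∂ν =
      2 * (1 / (N * M : ℝ) * ∫ ω, S N ω * S M ω ∂ν) := by ring
    have a5 : 4 * K / N = 4 * (K / N) := by ring
    rw [a4, a5]
    linarith
  have hSm : ∀ N, Measurable (S N) := fun N => Finset.measurable_sum _ fun i _ => hX i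
  -- The `L¹` norm of an increment is of order `(c m)^(-1/2)`, so the fourth power makes the
  -- increments summable, while `c (m + 1) / c m → 1` still allows the gaps to be filled.
  set c : ℕ → ℕ := fun m => (m + 1) ^ 4 with hc
  have hc0 : ∀ m, 0 < c m := fun m => by positivity
  have hcm : ∀ m, c m ≤ c (m + 1) := fun m => by simp only [hc]; gcongr; omega
  set Y : ℕ → Ω → ℝ := fun m ω => S (c m) ω / c m - S (c (m + 1)) ω / c (m + 1) with hY
  have hYm : ∀ m, Measurable (Y m) := fun m =>
    ((hSm _).div_const _).sub ((hSm _).div_const _)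
  have hYsq : ∀ m, Integrable (fun ω => Y m ω ^ 2) ν := fun m => by
    have : ∀ ω, Y m ω ^ 2 = (1 / (c m : ℝ) ^ 2) * (S (c m) ω * S (c m) ω)
        - (2 / (c m * c (m + 1) : ℝ)) * (S (c m) ω * S (c (m + 1)) ω)
        + (1 / (c (m + 1) : ℝ) ^ 2) * (S (c (m + 1)) ω * S (c (m + 1)) ω) := fun ω => by
      have h1 : (c m : ℝ) ≠ 0 := by exact_mod_cast (hc0 m).ne'
      have h2 : (c (m + 1) : ℝ) ≠ 0 := by exact_mod_cast (hc0 (m + 1)).ne'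
      simp only [hY]
      field_simp
      ring
    simp_rw [this]
    exact (((hSint _ _).const_mul _).sub ((hSint _ _).const_mul _)).add ((hSint _ _).const_mul _)
  have hYle : ∀ m, ∫⁻ ω, ENNReal.ofReal |Y m ω| ∂ν ≤
      ENNReal.ofReal ((4 * K + 1) * (1 / ((m + 1 : ℕ) : ℝ) ^ 2)) := fun m => by
    have ht : (0 : ℝ) < ((m + 1 : ℕ) : ℝ) ^ 2 := by positivity
    set t : ℝ := ((m + 1 : ℕ) : ℝ) ^ 2 with htdef
    have hct : (c m : ℝ) = t ^ 2 := by simp only [hc, htdef]; push_cast; ring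
    -- Completing the square replaces the Cauchy-Schwarz inequality here; `t = √(c m)` balances the
    -- two terms after integration.
    have hpt : ∀ ω, |Y m ω| ≤ t * Y m ω ^ 2 + 1 / t := fun ω => by
      have : t * Y m ω ^ 2 + 1 / t - |Y m ω| = (t * |Y m ω| - 1 / 2) ^ 2 / t + 3 / 4 / t := by
        rw [← sq_abs (Y m ω)]; field_simp; ring
      have h2 : 0 ≤ (t * |Y m ω| - 1 / 2) ^ 2 / t + 3 / 4 / t := by positivity
      linarith
    have hi : Integrable (fun ω => t * Y m ω ^ 2 + 1 / t) ν :=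
      ((hYsq m).const_mul t).add (integrable_const _)
    refine (lintegral_mono fun ω => ENNReal.ofReal_le_ofReal (hpt ω)).trans ?_
    rw [← ofReal_integral_eq_lintegral_ofReal hi
      (ae_of_all _ fun ω => by positivity)]
    refine ENNReal.ofReal_le_ofReal ?_
    rw [integral_add ((hYsq m).const_mul t) (integrable_const _), integral_const_mul]
    have h3 : ∫ ω, Y m ω ^ 2 ∂ν ≤ 4 * K / t ^ 2 := by
      have := hsq (c m) (c (m + 1)) (hc0 m) (hcm m)
      rw [hct] at this
      simpa only [hY, hct] using this
    have h4 : t * ∫ ω, Y m ω ^ 2 ∂ν ≤ 4 * K * (1 / t) := by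
      calc t * ∫ ω, Y m ω ^ 2 ∂ν ≤ t * (4 * K / t ^ 2) := by gcongr
        _ = _ := by field_simp
    simp only [integral_const, probReal_univ, one_smul]
    linarith
  have hsum : ∑' m, ∫⁻ ω, ENNReal.ofReal |Y m ω| ∂ν ≠ ∞ := by
    have hs : Summable fun m : ℕ => (4 * K + 1) * (1 / ((m + 1 : ℕ) : ℝ) ^ 2) :=
      ((summable_nat_add_iff 1).2 (Real.summable_one_div_nat_pow.2 (by norm_num))).mul_left _
    exact ne_top_of_le_ne_top hs.tsum_ofReal_ne_top (ENNReal.tsum_le_tsum hYle)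
  rw [← lintegral_tsum fun m => ((hYm m).abs.ennreal_ofReal).aemeasurable] at hsum
  have hfin := ae_lt_top (Measurable.tsum fun m => (hYm m).abs.ennreal_ofReal) hsum
  filter_upwards [hfin] with ω hω
  have hsummable : Summable fun m => |Y m ω| := by
    have := ENNReal.summable_toReal hω.ne
    simpa [ENNReal.toReal_ofReal] using this
  have hcau : CauchySeq fun m => S (c m) ω / c m :=
    cauchySeq_of_summable_dist (by simpa only [Real.dist_eq] using hsummable)
  obtain ⟨l, hl⟩ := cauchySeq_tendsto_of_complete hcau
  -- The summands are nonnegative, so the partial sums increase and convergence along the sparse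
  -- sequence `c` controls all `N` in between.
  refine ⟨l, tendsto_div_of_monotone_of_exists_subseq_tendsto_div (fun N => S N ω) l ?_ ?_⟩
  · exact monotone_nat_of_le_succ fun n => by
      simp only [hS, Finset.sum_range_succ]
      linarith [(h01 n ω).1]
  · intro a ha
    refine ⟨c, ?_, ?_, hl⟩
    · have h1 : Tendsto (fun n : ℕ => ((1 : ℝ) + 1 / ((n : ℝ) + 1)) ^ 4) atTop (𝓝 ((1 + 0) ^ 4)) :=
        (tendsto_const_nhds.add tendsto_one_div_add_atTop_nhds_zero_nat).pow 4
      have h2 : ((1 : ℝ) + 0) ^ 4 < a := by simpa using ha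
      filter_upwards [h1.eventually (gt_mem_nhds h2)] with n hn
      have h3 : (c (n + 1) : ℝ) = ((1 : ℝ) + 1 / ((n : ℝ) + 1)) ^ 4 * c n := by
        simp only [hc]; push_cast
        rw [← mul_pow]
        congr 1
        field_simp
      rw [h3]
      gcongr
    · refine tendsto_atTop_mono (fun n => ?_) tendsto_id
      simp only [hc, id]
      calc n ≤ n + 1 := Nat.le_succ n
        _ ≤ (n + 1) ^ 4 := Nat.le_self_pow (by norm_num) _

/-- A Komlós type theorem for countably many uniformly bounded sequences: along a common subsequence
the Cesàro means of all of them converge almost everywhere. -/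
theorem exists_strictMono_ae_tendsto_average {Ω : Type*} [MeasurableSpace Ω] (ν : Measure Ω)
    [IsProbabilityMeasure ν] (X : ℕ → ℕ → Ω → ℝ) (hX : ∀ k i, Measurable (X k i))
    (h01 : ∀ k i ω, X k i ω ∈ Set.Icc 0 1) :
    ∃ φ : ℕ → ℕ, StrictMono φ ∧ ∀ᵐ ω ∂ν, ∀ k, ∃ l,
      Tendsto (fun N : ℕ => (∑ i ∈ Finset.range N, X k (φ i) ω) / N) atTop (𝓝 l) := by
  have hG01 : ∀ k i j, ∫ ω, X k i ω * X k j ω ∂ν ∈ Set.Icc (-1 : ℝ) 1 := fun k i j => by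
    refine ⟨le_trans (by norm_num)
      (integral_nonneg fun ω => mul_nonneg (h01 k i ω).1 (h01 k j ω).1), ?_⟩
    refine (integral_mono_of_nonneg (ae_of_all _ fun ω => mul_nonneg (h01 k i ω).1 (h01 k j ω).1)
      (integrable_const 1)
      (ae_of_all _ fun ω => mul_le_one₀ (h01 k i ω).2 (h01 k j ω).1 (h01 k j ω).2)).trans ?_
    simp
  obtain ⟨φ, hφ, g, hg, hclose⟩ := exists_strictMono_gram_close _ hG01
  refine ⟨φ, hφ, ae_all_iff.2 fun k => ?_⟩
  -- The extraction controls row `k` only from `i = k` on. The factor `2 ^ k` absorbs the finitely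
  -- many earlier indices, where the trivial bound 2 is at most `2 * 2 ^ k * (1 / 2) ^ i`.
  refine ae_tendsto_average_of_gram_close ν (fun i => X k (φ i)) (fun i => hX k _)
    (fun i ω => h01 k _ ω) (g k) (2 * 2 ^ k) (hg k) (by positivity) fun i j hij => ?_
  have hpos : (0 : ℝ) < (1 / 2) ^ i := by positivity
  rcases le_or_gt k i with h | h
  · refine (hclose k i j h hij).trans ?_
    have : (1 : ℝ) ≤ 2 ^ k := one_le_pow₀ (by norm_num)
    nlinarith
  · have h1 : |∫ ω, X k (φ i) ω * X k (φ j) ω ∂ν - g k| ≤ 2 := by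
      have := hG01 k (φ i) (φ j)
      rw [abs_le]
      constructor <;> linarith [this.1, this.2, (hg k).1, (hg k).2]
    refine h1.trans ?_
    have h2 : (1 : ℝ) ≤ 2 ^ k * (1 / 2) ^ i := by
      have h3 : (2 : ℝ) ^ i * (1 / 2) ^ i = 1 := by rw [← mul_pow]; norm_num
      have h4 : (2 : ℝ) ^ i ≤ 2 ^ k := pow_le_pow_right₀ (by norm_num) h.le
      nlinarith
    linarith

/-! ### Separating functions and measurable limits -/

/-- A countable family of `[0, 1]`-valued continuous functions separates the probability measures
on a second countable metrizable space. -/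
theorem exists_seq_boundedContinuous_separating (Ω : Type*) [TopologicalSpace Ω]
    [SecondCountableTopology Ω] [HasOuterApproxClosed Ω] [MeasurableSpace Ω] [BorelSpace Ω] :
    ∃ g : ℕ → BoundedContinuousFunction Ω NNReal, (∀ k ω, g k ω ≤ 1) ∧
      ∀ μ ν : ProbabilityMeasure Ω,
        (∀ k, ∫⁻ ω, g k ω ∂(μ : Measure Ω) = ∫⁻ ω, g k ω ∂(ν : Measure Ω)) → μ = ν := by
  -- Complements of finite unions of basic open sets form a countable π-system of closed sets
  -- generating the Borel σ-field. The indicator of each is a limit of continuous functions, so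
  -- countably many integrals determine a probability measure.
  set S : Set (Set (Set Ω)) := {s | s.Finite ∧ s ⊆ TopologicalSpace.countableBasis Ω} with hS
  have hSc : S.Countable :=
    Set.countable_ofPred_finite_subset (TopologicalSpace.countable_countableBasis Ω)
  have hclosed : ∀ s : S, IsClosed (⋃₀ (s : Set (Set Ω)))ᶜ := fun s =>
    (isOpen_sUnion fun u hu =>
      TopologicalSpace.isOpen_of_mem_countableBasis (s.2.2 hu)).isClosed_compl
  have : Countable S := hSc.to_subtype
  have : Nonempty S := ⟨⟨∅, Set.finite_empty, Set.empty_subset _⟩⟩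
  obtain ⟨e, he⟩ := exists_surjective_nat (S × ℕ)
  refine ⟨fun k => (hclosed (e k).1).apprSeq (e k).2,
    fun k ω => HasOuterApproxClosed.apprSeq_apply_le_one _ _ _, fun μ ν h => ?_⟩
  have heq : ∀ s : S, (μ : Measure Ω) (⋃₀ (s : Set (Set Ω)))ᶜ =
      (ν : Measure Ω) (⋃₀ (s : Set (Set Ω)))ᶜ := fun s => by
    refine tendsto_nhds_unique
      (HasOuterApproxClosed.tendsto_lintegral_apprSeq (hclosed s) (μ : Measure Ω)) ?_
    have h2 := HasOuterApproxClosed.tendsto_lintegral_apprSeq (hclosed s) (ν : Measure Ω)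
    refine h2.congr fun n => ?_
    obtain ⟨k, hk⟩ := he (s, n)
    have := h k
    simp only [hk] at this
    exact this.symm
  refine Subtype.ext (show (μ : Measure Ω) = (ν : Measure Ω) from ext_of_generate_finite
    (Set.range fun s : S => (⋃₀ (s : Set (Set Ω)))ᶜ) ?_ ?_ ?_ ?_)
  · rw [BorelSpace.measurable_eq (α := Ω)]
    refine le_antisymm ?_ (MeasurableSpace.generateFrom_le ?_)
    · rw [(TopologicalSpace.isBasis_countableBasis Ω).borel_eq_generateFrom]
      refine MeasurableSpace.generateFrom_le fun u hu => ?_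
      have h3 : MeasurableSet[MeasurableSpace.generateFrom
          (Set.range fun s : S => (⋃₀ (s : Set (Set Ω)))ᶜ)] uᶜ := by
        refine MeasurableSpace.measurableSet_generateFrom
          ⟨⟨{u}, Set.finite_singleton u, Set.singleton_subset_iff.2 hu⟩, ?_⟩
        simp
      simpa using h3.compl
    · rintro _ ⟨s, rfl⟩
      exact MeasurableSet.compl (MeasurableSpace.measurableSet_generateFrom
        (isOpen_sUnion fun u hu => TopologicalSpace.isOpen_of_mem_countableBasis (s.2.2 hu)))
  · rintro _ ⟨s, rfl⟩ _ ⟨t, rfl⟩ -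
    refine ⟨⟨s ∪ t, s.2.1.union t.2.1, Set.union_subset s.2.2 t.2.2⟩, ?_⟩
    simp [Set.sUnion_union, Set.compl_union]
  · rintro _ ⟨s, rfl⟩
    exact heq s
  · simp

/-- Used with `Y` the space of probability measures under its weak topology. The σ-field on `Y` is
named explicitly, as Borel measurability for that topology is what a random Gibbs measure requires.
-/
theorem exists_measurable_borel_ae_tendsto {X Y ι : Type*} [TopologicalSpace X] [MeasurableSpace X]
    [OpensMeasurableSpace X] [TopologicalSpace Y] [TopologicalSpace.PseudoMetrizableSpace Y]
    [Nonempty ι] (ν : Measure X) {f : ι → X → Y} (hf : ∀ n, Continuous (f n)) {L : Filter ι}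
    [L.IsCountablyGenerated] (h : ∀ᵐ x ∂ν, ∃ l, Tendsto (fun n => f n x) L (𝓝 l)) :
    ∃ g : X → Y, Measurable[_, borel Y] g ∧ ∀ᵐ x ∂ν, Tendsto (fun n => f n x) L (𝓝 (g x)) := by
  let : MeasurableSpace Y := borel Y
  have : BorelSpace Y := ⟨rfl⟩
  exact measurable_limit_of_tendsto_metrizable_ae (fun n => (hf n).measurable.aemeasurable) h

/-! ### Energies on the whole lattice and consistency of the specification -/

namespace RandomSpin

open scoped BoundedContinuousFunction NNReal

variable {d : ℕ}

open Classical in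
/-- The edges with at least one endpoint in the finite set `Δ`. -/
noncomputable def edgesTouching (Δ : Finset (Site d)) : Finset (Edge d) :=
  (edgesIn (Δ ∪ Δ.biUnion neighbors)).filter fun e => ∃ x ∈ Δ, x ∈ (e : Sym2 (Site d))

theorem mem_edgesTouching {Δ : Finset (Site d)} {e : Edge d} :
    e ∈ edgesTouching Δ ↔ ∃ x ∈ Δ, x ∈ (e : Sym2 (Site d)) := by
  classical
  simp only [edgesTouching, Finset.mem_filter, and_iff_right_iff_imp, mem_edgesIn]
  rintro ⟨x, hx, hxe⟩ y hy
  obtain ⟨e, he⟩ := e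
  induction e using Sym2.ind with
  | _ a b =>
    have hab : (lattice d).Adj a b := he
    simp only [Sym2.mem_iff] at hxe hy
    simp only [Finset.mem_union, Finset.mem_biUnion, mem_neighbors]
    rcases hxe with rfl | rfl <;> rcases hy with rfl | rfl
    · exact Or.inl hx
    · exact Or.inr ⟨_, hx, hab⟩
    · exact Or.inr ⟨_, hx, hab.symm⟩
    · exact Or.inl hx

/-- The interaction energy of all the edges that touch `Δ`, with the sign changed, as a function of
the configuration on the whole lattice. -/
noncomputable def touchingEnergy (Δ : Finset (Site d)) (J : Edge d → ℝ) (η : Config d) : ℝ :=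
  ∑ e ∈ edgesTouching Δ, J e * spinProduct η e

/-- Writing the energy as a function of the glued configuration removes the separate roles of spins
and boundary condition, so that energies of different volumes can be compared. -/
theorem negEnergy_eq_touchingEnergy (Δ : Finset (Site d)) (J : Edge d → ℝ) (ξ : Config d)
    (σ : Δ → ℝ) : negEnergy Δ J ξ σ = touchingEnergy Δ J (glue Δ ξ σ) := by
  classical
  have hsub : edgesIn Δ ⊆ edgesTouching Δ := fun e he => by
    rw [mem_edgesIn] at he
    rw [mem_edgesTouching]
    obtain ⟨e, h⟩ := e
    induction e using Sym2.ind with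
    | _ a b => exact ⟨a, he a (by simp), by simp⟩
  unfold negEnergy touchingEnergy
  rw [← Finset.sum_sdiff hsub, add_comm, Finset.sum_sigma']
  congr 1
  have hadj : ∀ a ∈ (Finset.univ.sigma fun x : Δ => neighbors (x : Site d) \ Δ),
      s((a.1 : Site d), a.2) ∈ (lattice d).edgeSet := fun a ha => by
    simp only [Finset.mem_sigma, Finset.mem_sdiff, mem_neighbors] at ha
    exact ha.2.1
  -- An edge that touches `Δ` without lying inside it has exactly one endpoint in `Δ`, so it
  -- determines an ordered pair of an inner and an outer site.
  refine Finset.sum_bij (fun a ha => ⟨s((a.1 : Site d), a.2), hadj a ha⟩) ?_ ?_ ?_ ?_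
  · intro a ha
    simp only [Finset.mem_sigma, Finset.mem_sdiff] at ha
    simp only [Finset.mem_sdiff, mem_edgesTouching, mem_edgesIn]
    exact ⟨⟨a.1, a.1.2, by simp⟩, fun h => ha.2.2 (h a.2 (by simp))⟩
  · rintro ⟨⟨a, ha⟩, b⟩ h ⟨⟨a', ha'⟩, b'⟩ h' heq
    simp only [Finset.mem_sigma, Finset.mem_sdiff] at h h'
    simp only [Subtype.mk.injEq, Sym2.eq_iff] at heq
    rcases heq with ⟨rfl, rfl⟩ | ⟨rfl, rfl⟩
    · rfl
    · exact absurd ha h'.2.2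
  · rintro ⟨e, he⟩ h
    simp only [Finset.mem_sdiff, mem_edgesTouching, mem_edgesIn] at h
    obtain ⟨⟨x, hx, hxe⟩, h2⟩ := h
    obtain ⟨y, rfl⟩ := hxe
    have hy : y ∉ Δ := fun hy => h2 (by simp [hx, hy])
    exact ⟨⟨⟨x, hx⟩, y⟩, by simpa [mem_neighbors, hy] using he, rfl⟩
  · rintro ⟨⟨a, ha⟩, b⟩ h
    have hA := hadj _ h
    simp only [Finset.mem_sigma, Finset.mem_sdiff] at h
    have hA' : (lattice d).Adj a b := hA
    simp [coupling, hA', spinProduct, glue, ha, h.2.2, mul_assoc]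

theorem measurable_touchingEnergy (Δ : Finset (Site d)) (J : Edge d → ℝ) :
    Measurable (touchingEnergy Δ J) :=
  Finset.measurable_sum _ fun e _ => (measurable_spinProduct e).const_mul _

/-- The Boltzmann weight of the edges that touch `Δ`. -/
noncomputable def boltzmann (Δ : Finset (Site d)) (J : Edge d → ℝ) (η : Config d) : ℝ≥0∞ :=
  ENNReal.ofReal (Real.exp (touchingEnergy Δ J η))

theorem measurable_boltzmann (Δ : Finset (Site d)) (J : Edge d → ℝ) :
    Measurable (boltzmann Δ J) :=
  (measurable_touchingEnergy Δ J).exp.ennreal_ofReal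

/-- The integral over the spins in `Δ` with respect to the single-spin measures. -/
noncomputable def spinIntegral (χ : Site d → ProbabilityMeasure ℝ) (Δ : Finset (Site d))
    (f : Config d → ℝ≥0∞) (ξ : Config d) : ℝ≥0∞ :=
  ∫⁻ σ, f (glue Δ ξ σ) ∂productSpin χ Δ

open Classical in
-- Gives access to Tonelli's theorem for nested volumes and to measurability in the boundary
-- condition.
theorem spinIntegral_eq_lmarginal (χ : Site d → ProbabilityMeasure ℝ) (Δ : Finset (Site d))
    (f : Config d → ℝ≥0∞) :
    spinIntegral χ Δ f = lmarginal (fun x => (χ x : Measure ℝ)) Δ f := by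
  ext ξ
  unfold spinIntegral lmarginal productSpin
  congr! 2

theorem measurable_spinIntegral (χ : Site d → ProbabilityMeasure ℝ) (Δ : Finset (Site d))
    {f : Config d → ℝ≥0∞} (hf : Measurable f) : Measurable (spinIntegral χ Δ f) := by
  rw [spinIntegral_eq_lmarginal]
  exact hf.lmarginal _

open Classical in
theorem spinIntegral_of_subset (χ : Site d → ProbabilityMeasure ℝ) {Δ Λ : Finset (Site d)}
    (h : Δ ⊆ Λ) {f : Config d → ℝ≥0∞} (hf : Measurable f) :
    spinIntegral χ Λ f = spinIntegral χ (Λ \ Δ) (spinIntegral χ Δ f) := by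
  simp only [spinIntegral_eq_lmarginal]
  rw [← lmarginal_union _ _ hf Finset.sdiff_disjoint, Finset.sdiff_union_of_subset h]

theorem spinIntegral_congr_outside (χ : Site d → ProbabilityMeasure ℝ) (Δ : Finset (Site d))
    (f : Config d → ℝ≥0∞) {ξ η : Config d} (h : ∀ x ∉ Δ, ξ x = η x) :
    spinIntegral χ Δ f ξ = spinIntegral χ Δ f η := by
  classical
  rw [spinIntegral_eq_lmarginal]
  exact lmarginal_congr _ _ h

theorem glue_apply_of_notMem {Δ : Finset (Site d)} (ξ : Config d) (σ : Δ → ℝ) {x : Site d}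
    (hx : x ∉ Δ) : glue Δ ξ σ x = ξ x := by
  simp [glue, hx]

theorem glue_apply_of_mem {Δ : Finset (Site d)} (ξ : Config d) (σ : Δ → ℝ) {x : Site d}
    (hx : x ∈ Δ) : glue Δ ξ σ x = σ ⟨x, hx⟩ := by
  simp [glue, hx]

/-- Functions of the spins outside of `Δ` can be taken out of the integral over the spins in `Δ`. -/
theorem spinIntegral_mul_of_outside (χ : Site d → ProbabilityMeasure ℝ) (Δ : Finset (Site d))
    {f g : Config d → ℝ≥0∞} (hf : Measurable f)
    (hg : ∀ ξ η : Config d, (∀ x ∉ Δ, ξ x = η x) → g ξ = g η) (ξ : Config d) :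
    spinIntegral χ Δ (fun η => g η * f η) ξ = g ξ * spinIntegral χ Δ f ξ := by
  unfold spinIntegral
  rw [← lintegral_const_mul _ (show Measurable fun σ => f (glue Δ ξ σ) from
    hf.comp (measurable_glue Δ ξ))]
  refine lintegral_congr fun σ => ?_
  beta_reduce
  rw [hg (glue Δ ξ σ) ξ fun x hx => glue_apply_of_notMem ξ σ hx]

theorem partitionFunction_eq_spinIntegral (χ : Site d → ProbabilityMeasure ℝ)
    (Δ : Finset (Site d)) (J : Edge d → ℝ) (ξ : Config d) :
    partitionFunction χ Δ J ξ = spinIntegral χ Δ (boltzmann Δ J) ξ := by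
  simp only [partitionFunction, spinIntegral, boltzmann, negEnergy_eq_touchingEnergy]

theorem lintegral_kernelMeasure (χ : Site d → ProbabilityMeasure ℝ)
    (Δ : Finset (Site d)) (J : Edge d → ℝ) (ξ : Config d) {f : Config d → ℝ≥0∞}
    (hf : Measurable f) :
    ∫⁻ η, f η ∂kernelMeasure χ Δ J ξ =
      (partitionFunction χ Δ J ξ)⁻¹ * spinIntegral χ Δ (fun η => boltzmann Δ J η * f η) ξ := by
  rw [kernelMeasure, lintegral_smul_measure, lintegral_map hf (measurable_glue Δ ξ),
    lintegral_withDensity_eq_lintegral_mul _ (measurable_negEnergy Δ J ξ).exp.ennreal_ofReal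
      (show Measurable fun σ => f (glue Δ ξ σ) from hf.comp (measurable_glue Δ ξ))]
  simp only [spinIntegral, boltzmann, negEnergy_eq_touchingEnergy, Pi.mul_apply, smul_eq_mul]

theorem measurable_lintegral_kernelMeasure (χ : Site d → ProbabilityMeasure ℝ)
    (Δ : Finset (Site d)) (J : Edge d → ℝ) {f : Config d → ℝ≥0∞} (hf : Measurable f) :
    Measurable fun ξ => ∫⁻ η, f η ∂kernelMeasure χ Δ J ξ := by
  simp only [lintegral_kernelMeasure χ Δ J _ hf, partitionFunction_eq_spinIntegral]
  exact (measurable_spinIntegral χ Δ (measurable_boltzmann Δ J)).inv.mul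
    (measurable_spinIntegral χ Δ ((measurable_boltzmann Δ J).mul hf))

/-- The Boltzmann weight of `Λ ⊇ Δ` is the one of `Δ` times a function of the spins outside `Δ`. -/
theorem exists_boltzmann_eq_mul {Δ Λ : Finset (Site d)} (h : Δ ⊆ Λ) (J : Edge d → ℝ) :
    ∃ g : Config d → ℝ≥0∞, (∀ ξ η : Config d, (∀ x ∉ Δ, ξ x = η x) → g ξ = g η) ∧
      ∀ η, boltzmann Λ J η = g η * boltzmann Δ J η := by
  classical
  have hsub : edgesTouching Δ ⊆ edgesTouching Λ := fun e he => by
    rw [mem_edgesTouching] at he ⊢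
    obtain ⟨x, hx, hxe⟩ := he
    exact ⟨x, h hx, hxe⟩
  refine ⟨fun η => ENNReal.ofReal (Real.exp
    (∑ e ∈ edgesTouching Λ \ edgesTouching Δ, J e * spinProduct η e)), ?_, ?_⟩
  · intro ξ η hξη
    simp only
    congr 2
    refine Finset.sum_congr rfl fun e he => ?_
    rw [Finset.mem_sdiff, mem_edgesTouching (Δ := Δ)] at he
    have he2 := he.2
    push Not at he2
    obtain ⟨e, hE⟩ := e
    induction e using Sym2.ind with
    | _ a b =>
      have ha : a ∉ Δ := fun ha => he2 a ha (by simp)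
      have hb : b ∉ Δ := fun hb => he2 b hb (by simp)
      simp [spinProduct, hξη a ha, hξη b hb]
  · intro η
    unfold boltzmann touchingEnergy
    rw [← ENNReal.ofReal_mul (Real.exp_pos _).le, ← Real.exp_add, Finset.sum_sdiff hsub]

/-- Consistency of the specification: `π_Λ π_Δ = π_Λ` for `Δ ⊆ Λ`. -/
theorem lintegral_lintegral_kernelMeasure {q : ℝ} (hq : 1 < q) {χ : Site d → ProbabilityMeasure ℝ}
    (hχ : SingleSpinClass q χ) {Δ Λ : Finset (Site d)} (h : Δ ⊆ Λ) (J : Edge d → ℝ)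
    (ξ : Config d) {f : Config d → ℝ≥0∞} (hf : Measurable f) :
    ∫⁻ η, (∫⁻ ζ, f ζ ∂kernelMeasure χ Δ J η) ∂kernelMeasure χ Λ J ξ =
      ∫⁻ η, f η ∂kernelMeasure χ Λ J ξ := by
  rw [lintegral_kernelMeasure χ Λ J ξ (measurable_lintegral_kernelMeasure χ Δ J hf),
    lintegral_kernelMeasure χ Λ J ξ hf]
  congr 1
  obtain ⟨g, hg, hfac⟩ := exists_boltzmann_eq_mul h J
  have hbm := measurable_boltzmann Δ J
  set G : Config d → ℝ≥0∞ := fun η => ∫⁻ ζ, f ζ ∂kernelMeasure χ Δ J η with hG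
  have hGm : Measurable G := measurable_lintegral_kernelMeasure χ Δ J hf
  have hGo : ∀ ξ η : Config d, (∀ x ∉ Δ, ξ x = η x) → G ξ = G η := fun ξ η h => by
    simp only [hG, lintegral_kernelMeasure χ Δ J _ hf, partitionFunction_eq_spinIntegral]
    rw [spinIntegral_congr_outside χ Δ _ h, spinIntegral_congr_outside χ Δ _ h]
  -- It suffices to compare the integrals over the spins in `Δ`. There `g` and `G` are constant, and
  -- the partition function produced by integrating `boltzmann Δ J` cancels the normalization in
  -- `G`.
  have key : spinIntegral χ Δ (fun η => boltzmann Λ J η * G η) =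
      spinIntegral χ Δ (fun η => boltzmann Λ J η * f η) := by
    ext η
    have e1 : (fun η => boltzmann Λ J η * G η) = fun η => (g η * G η) * boltzmann Δ J η := by
      ext η; rw [hfac]; ring
    have e2 : (fun η => boltzmann Λ J η * f η) = fun η => g η * (boltzmann Δ J η * f η) := by
      ext η; rw [hfac]; ring
    rw [e1, e2, spinIntegral_mul_of_outside χ Δ hbm
      (g := fun η => g η * G η) (fun ξ η h => by simp only [hg ξ η h, hGo ξ η h]),
      spinIntegral_mul_of_outside χ Δ
        (show Measurable fun η => boltzmann Δ J η * f η from hbm.mul hf) hg, mul_assoc]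
    congr 1
    simp only [hG]
    rw [lintegral_kernelMeasure χ Δ J _ hf, ← partitionFunction_eq_spinIntegral, mul_right_comm,
      ENNReal.inv_mul_cancel (partitionFunction_ne_zero χ Δ J η)
        (partitionFunction_ne_top hq hχ Δ J η), one_mul]
  have hΛm := measurable_boltzmann Λ J
  rw [spinIntegral_of_subset χ h (show Measurable fun η => boltzmann Λ J η * G η from hΛm.mul hGm),
    spinIntegral_of_subset χ h (show Measurable fun η => boltzmann Λ J η * f η from hΛm.mul hf),
    key]

/-- The kernel leaves the configuration outside `Δ` unchanged; in particular the moments at outer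
sites are those of `ξ`. -/
theorem lintegral_kernelMeasure_of_outside {q : ℝ} (hq : 1 < q) {χ : Site d → ProbabilityMeasure ℝ}
    (hχ : SingleSpinClass q χ) (Δ : Finset (Site d)) (J : Edge d → ℝ)
    (ξ : Config d) {f : Config d → ℝ≥0∞} (hf : Measurable f)
    (hfo : ∀ ξ η : Config d, (∀ x ∉ Δ, ξ x = η x) → f ξ = f η) :
    ∫⁻ η, f η ∂kernelMeasure χ Δ J ξ = f ξ := by
  rw [lintegral_kernelMeasure χ Δ J ξ hf]
  simp_rw [mul_comm (boltzmann Δ J _)]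
  rw [spinIntegral_mul_of_outside χ Δ (measurable_boltzmann Δ J) hfo,
    ← partitionFunction_eq_spinIntegral, mul_left_comm,
    ENNReal.inv_mul_cancel (partitionFunction_ne_zero χ Δ J ξ)
      (partitionFunction_ne_top hq hχ Δ J ξ), mul_one]

/-! ### Moment estimates uniform in the volume -/

/-- Young's inequality for `t⁻¹ |j|` and `t |u v|` with exponents `q` and `r = q / (q - 1)`, where
`t ^ r = ε`. Then `|u v| ^ r` is bounded by `|u| ^ (2r) + |v| ^ (2r)`, and `2r = p`: this is the
origin of the exponent `p`. -/
theorem exists_abs_mul_mul_le {q : ℝ} (hq : 1 < q) {ε : ℝ} (hε : 0 < ε) :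
    ∃ C : ℝ, 0 ≤ C ∧ ∀ j u v : ℝ, |j * u * v| ≤
      C * |j| ^ q + ε * (|u| ^ spinExponent q + |v| ^ spinExponent q) := by
  have hconj := Real.HolderConjugate.conjExponent hq
  set r := Real.conjExponent q with hr
  have hq0 : 0 < q := by linarith
  have hr1 : 1 ≤ r := hconj.symm.lt.le
  have hr0 : 0 < r := by linarith
  have hp : spinExponent q = r * 2 := by
    rw [hr, Real.conjExponent, spinExponent]; ring
  set t : ℝ := ε ^ (1 / r) with ht
  have ht0 : 0 < t := Real.rpow_pos_of_pos hε _
  have htr : t ^ r = ε := by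
    rw [ht, ← Real.rpow_mul hε.le, one_div_mul_cancel hr0.ne', Real.rpow_one]
  refine ⟨(t⁻¹) ^ q / q, by positivity, fun j u v => ?_⟩
  have h1 := Real.young_inequality_of_nonneg (a := t⁻¹ * |j|) (b := t * (|u| * |v|))
    (by positivity) (by positivity) hconj
  have h2 : |j * u * v| = t⁻¹ * |j| * (t * (|u| * |v|)) := by
    rw [abs_mul, abs_mul]; field_simp
  rw [h2]
  refine h1.trans ?_
  rw [Real.mul_rpow (by positivity) (abs_nonneg j), Real.mul_rpow ht0.le (by positivity), htr,
    Real.mul_rpow (abs_nonneg u) (abs_nonneg v), hp, Real.rpow_mul (abs_nonneg u),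
    Real.rpow_mul (abs_nonneg v), Real.rpow_two, Real.rpow_two]
  set a := |u| ^ r
  set b := |v| ^ r
  have h3 : ε * (a * b) / r ≤ ε * (a ^ 2 + b ^ 2) := by
    rw [div_le_iff₀ hr0]
    have h4 : a * b ≤ (a ^ 2 + b ^ 2) * r := by nlinarith [sq_nonneg (a - b), sq_nonneg a, sq_nonneg b]
    nlinarith
  have h5 : (t⁻¹) ^ q * |j| ^ q / q = (t⁻¹) ^ q / q * |j| ^ q := by ring
  linarith

theorem card_neighbors_le (x : Site d) : (neighbors x).card ≤ 3 ^ d := by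
  classical
  refine (Finset.card_filter_le _ _).trans ?_
  rw [Pi.card_Icc]
  refine (Finset.prod_le_pow_card _ _ 3 fun i _ => ?_).trans (by simp)
  simp [Int.card_Icc]
  omega

theorem touchingEnergy_singleton (x : Site d) (J : Edge d → ℝ) (ξ : Config d) (u : ℝ) :
    touchingEnergy {x} J (Function.update ξ x u) =
      ∑ y ∈ neighbors x, coupling J x y * u * ξ y := by
  classical
  have hglue : Function.update ξ x u = glue {x} ξ fun _ => u := by
    ext y
    by_cases h : y = x
    · subst h; simp [glue]
    · simp [glue, h]
  have hempty : edgesIn ({x} : Finset (Site d)) = ∅ := by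
    refine Finset.eq_empty_of_forall_notMem fun e he => ?_
    rw [mem_edgesIn] at he
    obtain ⟨e, hE⟩ := e
    induction e using Sym2.ind with
    | _ a b =>
      have ha : a = x := by simpa using he a (by simp)
      have hb : b = x := by simpa using he b (by simp)
      subst ha; subst hb
      exact (lattice d).loopless.irrefl _ hE
  have hn : neighbors x \ {x} = neighbors x := by
    rw [Finset.sdiff_singleton_eq_erase]
    refine Finset.erase_eq_of_notMem fun h => ?_
    exact (lattice d).loopless.irrefl _ (mem_neighbors.1 h)
  rw [hglue, ← negEnergy_eq_touchingEnergy, negEnergy, hempty]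
  simp [hn]

theorem spinIntegral_singleton (χ : Site d → ProbabilityMeasure ℝ) (x : Site d)
    (f : Config d → ℝ≥0∞) (ξ : Config d) :
    spinIntegral χ {x} f ξ = ∫⁻ u, f (Function.update ξ x u) ∂(χ x : Measure ℝ) := by
  classical
  rw [spinIntegral_eq_lmarginal, lmarginal_singleton]

/-- The single-site moment estimate. -/
theorem exists_lintegral_kernelMeasure_singleton_le {q : ℝ} (hq : 1 < q)
    {χ : Site d → ProbabilityMeasure ℝ} (hχ : SingleSpinClass q χ) {ε : ℝ} (hε : 0 < ε) :
    ∃ A B : ℝ, ∀ (J : Edge d → ℝ) (x : Site d) (ξ : Config d),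
      ∫⁻ η, ENNReal.ofReal (|η x| ^ spinExponent q) ∂kernelMeasure χ {x} J ξ ≤
        ENNReal.ofReal A + (ENNReal.ofReal B *
            ∑ y ∈ neighbors x, ENNReal.ofReal (|coupling J x y| ^ q) +
          ENNReal.ofReal ε * ∑ y ∈ neighbors x, ENNReal.ofReal (|ξ y| ^ spinExponent q)) := by
  set p := spinExponent q with hp
  -- The bound `1 / 3 ^ d` keeps the sum over neighbours of `δ |u| ^ p` below `|u| ^ p`. The bound
  -- `ε / 2` is needed because `H` enters twice, from the numerator and from the partition function.
  set δ : ℝ := min (ε / 2) (1 / 3 ^ d) with hδ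
  have hδ0 : 0 < δ := by positivity
  obtain ⟨C, hC, hyoung⟩ := exists_abs_mul_mul_le hq hδ0
  -- In the numerator one `|u| ^ p` comes from the energy and one from the exponential moment being
  -- estimated, hence the parameter 2; the partition function needs only 1.
  set a₀ : ℝ≥0∞ := ⨆ x, ∫⁻ u, ENNReal.ofReal (Real.exp (2 * |u| ^ p)) ∂(χ x : Measure ℝ) with ha₀
  set b₀ : ℝ≥0∞ := ⨅ x, ∫⁻ u, ENNReal.ofReal (Real.exp (-(1 * |u| ^ p))) ∂(χ x : Measure ℝ)
    with hb₀
  have ha : a₀ < ∞ := hχ.upper 2 two_pos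
  have hb : 0 < b₀ := hχ.lower 1 one_pos
  have hR : b₀⁻¹ * a₀ ≠ ∞ := ENNReal.mul_ne_top (ENNReal.inv_ne_top.2 hb.ne') ha.ne
  set R : ℝ := (b₀⁻¹ * a₀).toReal with hRdef
  have hR0 : 0 ≤ R := ENNReal.toReal_nonneg
  refine ⟨R + 1, 2 * C, fun J x ξ => ?_⟩
  set P : ℝ := ∑ y ∈ neighbors x, |coupling J x y| ^ q with hP
  set Q : ℝ := ∑ y ∈ neighbors x, |ξ y| ^ p with hQ
  have hP0 : 0 ≤ P := Finset.sum_nonneg fun _ _ => Real.rpow_nonneg (abs_nonneg _) _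
  have hQ0 : 0 ≤ Q := Finset.sum_nonneg fun _ _ => Real.rpow_nonneg (abs_nonneg _) _
  set H : ℝ := C * P + δ * Q with hH
  have hener : ∀ u : ℝ, |touchingEnergy {x} J (Function.update ξ x u)| ≤ H + |u| ^ p := fun u => by
    have hu : 0 ≤ |u| ^ p := Real.rpow_nonneg (abs_nonneg _) _
    rw [touchingEnergy_singleton]
    refine (Finset.abs_sum_le_sum_abs _ _).trans ?_
    refine (Finset.sum_le_sum fun y _ => hyoung (coupling J x y) u (ξ y)).trans ?_
    have hcard : ((neighbors x).card : ℝ) * δ ≤ 1 := by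
      have h1 : ((neighbors x).card : ℝ) ≤ 3 ^ d := by exact_mod_cast card_neighbors_le x
      calc ((neighbors x).card : ℝ) * δ ≤ 3 ^ d * (1 / 3 ^ d) := by
            gcongr; exact min_le_right _ _
        _ = 1 := by field_simp
    simp only [mul_add, Finset.sum_add_distrib, ← Finset.mul_sum, Finset.sum_const, nsmul_eq_mul]
    rw [hH]
    nlinarith
  set Z := partitionFunction χ {x} J ξ with hZ
  have hZle : ENNReal.ofReal (Real.exp (-H)) * b₀ ≤ Z := by
    rw [hZ, partitionFunction_eq_spinIntegral, spinIntegral_singleton]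
    refine (mul_le_mul_right (iInf_le _ x) _).trans ?_
    rw [← lintegral_const_mul _ (by fun_prop)]
    refine lintegral_mono fun u => ?_
    rw [← ENNReal.ofReal_mul (Real.exp_pos _).le, ← Real.exp_add, boltzmann]
    refine ENNReal.ofReal_le_ofReal (Real.exp_le_exp.2 ?_)
    linarith [(abs_le.1 (hener u)).1]
  have hnum : spinIntegral χ {x}
      (fun η => boltzmann {x} J η * ENNReal.ofReal (Real.exp (|η x| ^ p))) ξ ≤
      ENNReal.ofReal (Real.exp H) * a₀ := by
    rw [spinIntegral_singleton]
    refine le_trans ?_ (mul_le_mul_right (le_iSup (fun x => ∫⁻ u,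
      ENNReal.ofReal (Real.exp (2 * |u| ^ p)) ∂(χ x : Measure ℝ)) x) _)
    rw [← lintegral_const_mul _ (by fun_prop)]
    refine lintegral_mono fun u => ?_
    simp only [Function.update_self]
    rw [boltzmann, ← ENNReal.ofReal_mul (Real.exp_pos _).le,
      ← ENNReal.ofReal_mul (Real.exp_pos _).le, ← Real.exp_add, ← Real.exp_add]
    refine ENNReal.ofReal_le_ofReal (Real.exp_le_exp.2 ?_)
    linarith [(abs_le.1 (hener u)).2]
  have hm : Measurable fun η : Config d => ENNReal.ofReal (Real.exp (|η x| ^ p)) := by fun_prop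
  have hexp : ∫⁻ η, ENNReal.ofReal (Real.exp (|η x| ^ p)) ∂kernelMeasure χ {x} J ξ ≤
      ENNReal.ofReal (Real.exp (2 * H + R)) := by
    rw [lintegral_kernelMeasure χ {x} J ξ hm]
    calc Z⁻¹ * spinIntegral χ {x}
          (fun η => boltzmann {x} J η * ENNReal.ofReal (Real.exp (|η x| ^ p))) ξ
        ≤ (ENNReal.ofReal (Real.exp (-H)) * b₀)⁻¹ * (ENNReal.ofReal (Real.exp H) * a₀) := by
          gcongr
      _ = ENNReal.ofReal (Real.exp (2 * H)) * (b₀⁻¹ * a₀) := by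
          rw [ENNReal.mul_inv (Or.inl (ENNReal.ofReal_pos.2 (Real.exp_pos _)).ne') (Or.inl ENNReal.ofReal_ne_top),
            ← ENNReal.ofReal_inv_of_pos (Real.exp_pos _), ← Real.exp_neg, neg_neg,
            mul_mul_mul_comm, ← ENNReal.ofReal_mul (Real.exp_pos _).le, ← Real.exp_add, two_mul]
      _ ≤ ENNReal.ofReal (Real.exp (2 * H)) * ENNReal.ofReal (Real.exp R) := by
          gcongr
          rw [← ENNReal.ofReal_toReal hR]
          exact ENNReal.ofReal_le_ofReal (by linarith [Real.add_one_le_exp R])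
      _ = _ := by rw [← ENNReal.ofReal_mul (Real.exp_pos _).le, ← Real.exp_add]
  set a : ℝ := 2 * H + R with ha'
  have := isProbabilityMeasure_kernelMeasure hq hχ {x} J ξ
  -- The inequality `s ≤ a + exp (s - a)` takes the place of Jensen's and passes from the
  -- exponential moment to the moment itself at the cost of an additive 1.
  calc ∫⁻ η, ENNReal.ofReal (|η x| ^ p) ∂kernelMeasure χ {x} J ξ
      ≤ ∫⁻ η, (ENNReal.ofReal a + ENNReal.ofReal (Real.exp (-a)) *
          ENNReal.ofReal (Real.exp (|η x| ^ p))) ∂kernelMeasure χ {x} J ξ := by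
        refine lintegral_mono fun η => ?_
        rw [← ENNReal.ofReal_mul (Real.exp_pos _).le, ← Real.exp_add]
        refine le_trans (ENNReal.ofReal_le_ofReal ?_) ENNReal.ofReal_add_le
        linarith [Real.add_one_le_exp (-a + |η x| ^ p)]
    _ ≤ ENNReal.ofReal a + ENNReal.ofReal (Real.exp (-a)) * ENNReal.ofReal (Real.exp a) := by
        rw [lintegral_add_left measurable_const, lintegral_const_mul _ hm, lintegral_const,
          measure_univ, mul_one]
        gcongr
    _ = ENNReal.ofReal a + ENNReal.ofReal 1 := by
        rw [← ENNReal.ofReal_mul (Real.exp_pos _).le, ← Real.exp_add, neg_add_cancel, Real.exp_zero]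
    _ = ENNReal.ofReal (a + 1) := (ENNReal.ofReal_add (by positivity) zero_le_one).symm
    _ ≤ ENNReal.ofReal ((R + 1) + (2 * C * P + ε * Q)) := by
        refine ENNReal.ofReal_le_ofReal ?_
        have : δ ≤ ε / 2 := min_le_left _ _
        rw [ha', hH]
        nlinarith
    _ = _ := by
        rw [ENNReal.ofReal_add (p := R + 1) (by positivity) (by positivity),
          ENNReal.ofReal_add (p := 2 * C * P) (by positivity) (by positivity),
          ENNReal.ofReal_mul (p := 2 * C) (by positivity), ENNReal.ofReal_mul (p := ε) hε.le,
          ENNReal.ofReal_sum_of_nonneg fun _ _ => Real.rpow_nonneg (abs_nonneg _) _,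
          ENNReal.ofReal_sum_of_nonneg fun _ _ => Real.rpow_nonneg (abs_nonneg _) _]

theorem lintegral_exp_lt_top_of_dominated {q : ℝ} {χ : Site d → ProbabilityMeasure ℝ}
    (hχ : SingleSpinClass q χ) {Δ : Finset (Site d)} (C : ℝ) {K : ℝ} (hK : 0 ≤ K) :
    ∫⁻ σ, ENNReal.ofReal (Real.exp (C + K * ∑ x, |σ x| ^ spinExponent q)) ∂productSpin χ Δ < ∞ := by
  set p := spinExponent q
  -- The exponential moments are given for positive parameters only, hence `K + 1` instead of `K`.
  have hle : ∀ σ : Δ → ℝ, Real.exp (C + K * ∑ x, |σ x| ^ p) ≤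
      Real.exp C * ∏ x, Real.exp ((K + 1) * |σ x| ^ p) := fun σ => by
    rw [← Real.exp_sum, ← Real.exp_add, ← Finset.mul_sum]
    have hS : 0 ≤ ∑ x, |σ x| ^ p :=
      Finset.sum_nonneg fun x _ => Real.rpow_nonneg (abs_nonneg _) _
    exact Real.exp_le_exp.2 (by linarith)
  have hint : ∀ x : Δ,
      Integrable (fun u : ℝ => Real.exp ((K + 1) * |u| ^ p)) (χ x : Measure ℝ) := fun x => by
    refine ⟨Measurable.aestronglyMeasurable (by fun_prop), ?_⟩
    rw [hasFiniteIntegral_iff_ofReal (ae_of_all _ fun u => (Real.exp_pos _).le)]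
    refine lt_of_le_of_lt ?_ (hχ.upper (K + 1) (by linarith))
    exact le_iSup (fun x => ∫⁻ u, ENNReal.ofReal (Real.exp ((K + 1) * |u| ^ p))
      ∂(χ x : Measure ℝ)) (x : Site d)
  have h2 := ((Integrable.fintype_prod hint).const_mul (Real.exp C)).2
  rw [hasFiniteIntegral_iff_ofReal (ae_of_all _ fun σ => mul_nonneg (Real.exp_pos _).le
    (Finset.prod_nonneg fun x _ => (Real.exp_pos _).le))] at h2
  exact (lintegral_mono fun σ => ENNReal.ofReal_le_ofReal (hle σ)).trans_lt h2

/-- Finiteness without uniformity in `Δ`. It is what later permits a multiple of the weighted moment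
sum to be subtracted from both sides. One more unit in `K` accounts for the moment, bounded by an
exponential. -/
theorem lintegral_moment_kernelMeasure_lt_top {q : ℝ} (hq : 1 < q)
    {χ : Site d → ProbabilityMeasure ℝ} (hχ : SingleSpinClass q χ) (Δ : Finset (Site d))
    (J : Edge d → ℝ) (ξ : Config d) {x : Site d} (hx : x ∈ Δ) :
    ∫⁻ η, ENNReal.ofReal (|η x| ^ spinExponent q) ∂kernelMeasure χ Δ J ξ < ∞ := by
  rw [lintegral_kernelMeasure χ Δ J ξ (by fun_prop)]
  refine ENNReal.mul_lt_top (ENNReal.inv_lt_top.2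
    (pos_iff_ne_zero.2 (partitionFunction_ne_zero χ Δ J ξ))) ?_
  obtain ⟨C, K, hK, hdom⟩ := dominated_negEnergy (two_le_spinExponent hq) Δ J ξ
  refine lt_of_le_of_lt (lintegral_mono fun σ => ?_)
    (lintegral_exp_lt_top_of_dominated hχ C (by linarith : 0 ≤ K + 1))
  beta_reduce
  rw [boltzmann, ← negEnergy_eq_touchingEnergy, glue_apply_of_mem ξ σ hx,
    ← ENNReal.ofReal_mul (Real.exp_pos _).le]
  refine ENNReal.ofReal_le_ofReal ?_
  have h1 : |σ ⟨x, hx⟩| ^ spinExponent q ≤ ∑ x, |σ x| ^ spinExponent q :=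
    Finset.single_le_sum (f := fun x => |σ x| ^ spinExponent q)
      (fun x _ => Real.rpow_nonneg (abs_nonneg _) _) (Finset.mem_univ _)
  have h2 : |σ ⟨x, hx⟩| ^ spinExponent q ≤ Real.exp (∑ x, |σ x| ^ spinExponent q) := by
    linarith [Real.add_one_le_exp (∑ x, |σ x| ^ spinExponent q)]
  calc _ ≤ Real.exp (C + K * ∑ x, |σ x| ^ spinExponent q) *
        Real.exp (∑ x, |σ x| ^ spinExponent q) := by
        gcongr
        exact hdom σ
    _ = _ := by rw [← Real.exp_add]; ring_nf

/-- After exchanging the sums, `m y` is counted once for each of the at most `3 ^ d` neighbours of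
`y`, whose weights are at most `w₀ w(y)`. -/
theorem tsum_weight_sum_neighbors_le (w : Weight d) :
    ∃ L : ℝ, 0 < L ∧ ∀ m : Site d → ℝ≥0∞,
      ∑' x, ENNReal.ofReal (w x) * ∑ y ∈ neighbors x, m y ≤
        ENNReal.ofReal L * ∑' y, ENNReal.ofReal (w y) * m y := by
  classical
  obtain ⟨w₀, hw₀, hratio⟩ := w.ratio
  refine ⟨3 ^ d * w₀, by positivity, fun m => ?_⟩
  have h1 : ∀ x, ENNReal.ofReal (w x) * ∑ y ∈ neighbors x, m y =
      ∑' y, if y ∈ neighbors x then ENNReal.ofReal (w x) * m y else 0 := fun x => by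
    rw [tsum_eq_sum (s := neighbors x) (fun y hy => if_neg hy), Finset.mul_sum]
    exact Finset.sum_congr rfl fun y hy => (if_pos hy).symm
  simp_rw [h1]
  rw [ENNReal.tsum_comm, ← ENNReal.tsum_mul_left]
  refine ENNReal.tsum_le_tsum fun y => ?_
  have h2 : ∀ x, (if y ∈ neighbors x then ENNReal.ofReal (w x) * m y else 0) ≤
      if x ∈ neighbors y then ENNReal.ofReal (w₀ * w y) * m y else 0 := fun x => by
    simp only [mem_neighbors]
    by_cases h : (lattice d).Adj x y
    · rw [if_pos h, if_pos h.symm]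
      gcongr
      exact hratio x y h
    · rw [if_neg h]; exact zero_le
  refine (ENNReal.tsum_le_tsum h2).trans ?_
  rw [tsum_eq_sum (s := neighbors y) (fun x hx => if_neg hx),
    Finset.sum_congr rfl fun x hx => if_pos hx, Finset.sum_const, nsmul_eq_mul, ← mul_assoc,
    ← mul_assoc]
  rw [ENNReal.ofReal_mul hw₀.le, ENNReal.ofReal_mul (p := 3 ^ d) (by positivity), ← mul_assoc]
  gcongr
  rw [ENNReal.ofReal_pow (by norm_num)]
  have := card_neighbors_le y
  norm_num
  exact_mod_cast this

/-- Each edge is met once from either endpoint, so it collects exactly the weight `w(x) + w(y)` of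
the norm on `𝒥_q`. -/
theorem tsum_weight_sum_coupling_le (w : Weight d) (q : ℝ) (J : Edge d → ℝ) :
    ∑' x, ENNReal.ofReal (w x) * ∑ y ∈ neighbors x, ENNReal.ofReal (|coupling J x y| ^ q) ≤
      ∑' e, ENNReal.ofReal (|J e| ^ q * w.edge e) := by
  classical
  have h1 : ∀ x, ∑ y ∈ neighbors x, ENNReal.ofReal (|coupling J x y| ^ q) ≤
      ∑' e : Edge d, if x ∈ (e : Sym2 (Site d)) then ENNReal.ofReal (|J e| ^ q) else 0 := fun x => by
    let i : neighbors x → Edge d := fun y => ⟨s(x, (y : Site d)), mem_neighbors.1 y.2⟩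
    have hi : Function.Injective i := fun y z h => by
      have : s(x, (y : Site d)) = s(x, (z : Site d)) := congrArg Subtype.val h
      exact Subtype.ext (Sym2.congr_right.1 this)
    rw [← Finset.sum_coe_sort, ← tsum_fintype (L := .unconditional _)]
    refine le_trans (le_of_eq (tsum_congr fun y => ?_))
      (ENNReal.tsum_comp_le_tsum_of_injective hi _)
    have hadj : (lattice d).Adj x y := mem_neighbors.1 y.2
    simp [i, coupling, hadj]
  calc _ ≤ ∑' x, ∑' e : Edge d,
        if x ∈ (e : Sym2 (Site d)) then ENNReal.ofReal (w x) * ENNReal.ofReal (|J e| ^ q) else 0 := by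
        refine ENNReal.tsum_le_tsum fun x => ?_
        refine (mul_le_mul_right (h1 x) _).trans ?_
        rw [← ENNReal.tsum_mul_left]
        simp
    _ ≤ _ := by
        rw [ENNReal.tsum_comm]
        refine ENNReal.tsum_le_tsum fun e => ?_
        obtain ⟨e, he⟩ := e
        induction e using Sym2.ind with
        | _ a b =>
          have hab : a ≠ b := (show (lattice d).Adj a b from he).ne
          rw [tsum_eq_sum (s := {a, b}) (fun x hx => if_neg (by simpa using hx)),
            Finset.sum_pair hab]
          simp only [Sym2.mem_iff, true_or, or_true, if_true, Weight.edge, Sym2.lift_mk]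
          rw [← add_mul, ← ENNReal.ofReal_add (w.pos a).le (w.pos b).le,
            ← ENNReal.ofReal_mul (add_pos (w.pos a) (w.pos b)).le, mul_comm]

/-- The weighted moments of the kernels `π_Δ(· | J, ξ)` are bounded uniformly in `Δ`. -/
theorem exists_tsum_moment_kernelMeasure_le {w : Weight d} {q : ℝ} [hq : Fact (1 < q)]
    {χ : Site d → ProbabilityMeasure ℝ} (hχ : SingleSpinClass q χ) (J : Interaction w q)
    {ξ : Config d} (hξ : ξ ∈ temperedConfigs w (spinExponent q)) :
    ∃ K : ℝ≥0∞, K ≠ ∞ ∧ ∀ Δ : Finset (Site d),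
      ∑' x, ENNReal.ofReal (w x) *
        ∫⁻ η, ENNReal.ofReal (|η x| ^ spinExponent q) ∂kernelMeasure χ Δ J.val ξ ≤ K := by
  set p := spinExponent q with hp
  obtain ⟨L, hL, hneigh⟩ := tsum_weight_sum_neighbors_le w
  -- With `ε = 1 / (2L)` the neighbour term contributes at most half of the whole weighted sum.
  obtain ⟨A, B, hsite⟩ := exists_lintegral_kernelMeasure_singleton_le hq.out hχ
    (show (0 : ℝ) < 1 / (2 * L) by positivity)
  set V : ℝ≥0∞ := ∑' x, ENNReal.ofReal (w x) * ENNReal.ofReal (|ξ x| ^ p) with hV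
  have hVt : V ≠ ∞ := by
    have : ∀ x, ENNReal.ofReal (w x) * ENNReal.ofReal (|ξ x| ^ p) =
        ENNReal.ofReal (|ξ x| ^ p * w x) := fun x => by
      rw [mul_comm, ENNReal.ofReal_mul (Real.rpow_nonneg (abs_nonneg _) _)]
    rw [hV, tsum_congr this]
    exact Summable.tsum_ofReal_ne_top hξ
  set W : ℝ≥0∞ := ∑' e, ENNReal.ofReal (|J.val e| ^ q * w.edge e) with hW
  have hWt : W ≠ ∞ := Summable.tsum_ofReal_ne_top J.2
  set U : ℝ≥0∞ := ∑' x, ENNReal.ofReal (w x) with hU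
  have hUt : U ≠ ∞ := Summable.tsum_ofReal_ne_top w.summable
  set K₀ : ℝ≥0∞ := V + (U * ENNReal.ofReal A + ENNReal.ofReal B * W) with hK₀
  have hK₀t : K₀ ≠ ∞ := ENNReal.add_ne_top.2 ⟨hVt, ENNReal.add_ne_top.2
    ⟨ENNReal.mul_ne_top hUt ENNReal.ofReal_ne_top, ENNReal.mul_ne_top ENNReal.ofReal_ne_top hWt⟩⟩
  refine ⟨2 * K₀, ENNReal.mul_ne_top ENNReal.ofNat_ne_top hK₀t, fun Δ => ?_⟩
  set m : Site d → ℝ≥0∞ := fun x => ∫⁻ η, ENNReal.ofReal (|η x| ^ p) ∂kernelMeasure χ Δ J.val ξ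
    with hm
  have hmeas : ∀ x, Measurable fun η : Config d => ENNReal.ofReal (|η x| ^ p) := fun x => by
    fun_prop
  have hout : ∀ x ∉ Δ, m x = ENNReal.ofReal (|ξ x| ^ p) := fun x hx =>
    lintegral_kernelMeasure_of_outside hq.out hχ Δ J.val ξ (hmeas x)
      fun ξ η h => by rw [h x hx]
  set S : ℝ≥0∞ := ∑' x, ENNReal.ofReal (w x) * m x with hS
  -- Finitely many finite terms from `Δ`, plus the weighted energy of the tempered `ξ`.
  have hSt : S ≠ ∞ := by
    classical
    have h1 : S ≤ ∑' x, ((if x ∈ Δ then ENNReal.ofReal (w x) * m x else 0) +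
        ENNReal.ofReal (w x) * ENNReal.ofReal (|ξ x| ^ p)) := by
      refine ENNReal.tsum_le_tsum fun x => ?_
      by_cases hx : x ∈ Δ
      · rw [if_pos hx]; exact le_self_add
      · rw [if_neg hx, zero_add, hout x hx]
    refine ne_top_of_le_ne_top ?_ h1
    rw [ENNReal.tsum_add, tsum_eq_sum (s := Δ) (fun x hx => if_neg hx)]
    refine ENNReal.add_ne_top.2 ⟨?_, hVt⟩
    refine ENNReal.sum_ne_top.2 fun x hx => ?_
    rw [if_pos hx]
    exact ENNReal.mul_ne_top ENNReal.ofReal_ne_top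
      (lintegral_moment_kernelMeasure_lt_top hq.out hχ Δ J.val ξ hx).ne
  set ε : ℝ := 1 / (2 * L) with hε
  -- By consistency the spin at `x` may first be resampled given all the others, so the single-site
  -- estimate can be integrated against `π_Δ`.
  have hin : ∀ x ∈ Δ, m x ≤ ENNReal.ofReal A + (ENNReal.ofReal B *
      ∑ y ∈ neighbors x, ENNReal.ofReal (|coupling J.val x y| ^ q) +
        ENNReal.ofReal ε * ∑ y ∈ neighbors x, m y) := fun x hx => by
    have := isProbabilityMeasure_kernelMeasure hq.out hχ Δ J.val ξ
    have h1 := lintegral_lintegral_kernelMeasure hq.out hχ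
      (Finset.singleton_subset_iff.2 hx) J.val ξ (hmeas x)
    simp only [hm]
    rw [← h1]
    refine (lintegral_mono fun η => hsite J.val x η).trans ?_
    rw [lintegral_add_left measurable_const, lintegral_add_left measurable_const, lintegral_const,
      lintegral_const, measure_univ, mul_one, mul_one, lintegral_const_mul _
        (Finset.measurable_sum _ fun y _ => hmeas y),
      lintegral_finsetSum _ fun y _ => hmeas y]
  have hall : ∀ x, ENNReal.ofReal (w x) * m x ≤
      ENNReal.ofReal (w x) * ENNReal.ofReal (|ξ x| ^ p) + (ENNReal.ofReal (w x) * ENNReal.ofReal A +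
        (ENNReal.ofReal B * (ENNReal.ofReal (w x) *
          ∑ y ∈ neighbors x, ENNReal.ofReal (|coupling J.val x y| ^ q)) +
        ENNReal.ofReal ε * (ENNReal.ofReal (w x) * ∑ y ∈ neighbors x, m y))) := fun x => by
    by_cases hx : x ∈ Δ
    · refine le_trans (mul_le_mul_right (hin x hx) _) (le_trans (le_of_eq ?_) le_add_self)
      ring
    · rw [hout x hx]; exact le_self_add
  have hbound : S ≤ K₀ + ENNReal.ofReal (1 / 2) * S := by
    refine (ENNReal.tsum_le_tsum hall).trans ?_
    rw [ENNReal.tsum_add, ENNReal.tsum_add, ENNReal.tsum_add, ENNReal.tsum_mul_right,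
      ENNReal.tsum_mul_left, ENNReal.tsum_mul_left, hK₀, add_assoc, add_assoc]
    refine add_le_add le_rfl (add_le_add le_rfl (add_le_add ?_ ?_))
    · exact mul_le_mul_right (tsum_weight_sum_coupling_le w q J.val) _
    · calc _ ≤ ENNReal.ofReal ε * (ENNReal.ofReal L * S) := by gcongr; exact hneigh m
        _ = _ := by
          rw [← mul_assoc, ← ENNReal.ofReal_mul (by positivity)]
          congr 2
          rw [hε]; field_simp
  have hhalf : ENNReal.ofReal (1 / 2) = 2⁻¹ := by
    rw [one_div, ENNReal.ofReal_inv_of_pos two_pos]; norm_num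
  rw [hhalf] at hbound
  -- Half of `S` is absorbed on the left, which is legitimate since `S` is finite.
  have h2 : 2⁻¹ * S + 2⁻¹ * S ≤ K₀ + 2⁻¹ * S := by
    rwa [← add_mul, ENNReal.inv_two_add_inv_two, one_mul]
  have h3 : 2⁻¹ * S ≤ K₀ := (ENNReal.add_le_add_iff_right
    (ENNReal.mul_ne_top (by simp) hSt)).1 h2
  calc S = 2 * (2⁻¹ * S) := by
        rw [← mul_assoc, ENNReal.mul_inv_cancel two_ne_zero ENNReal.ofNat_ne_top, one_mul]
    _ ≤ 2 * K₀ := by gcongr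

/-! ### Continuity of the kernels in the intensities and the boundary condition -/

theorem continuous_spinProduct (e : Edge d) : Continuous fun σ : Config d => spinProduct σ e := by
  obtain ⟨e, he⟩ := e
  induction e using Sym2.ind with
  | _ x y => exact (continuous_apply x).mul (continuous_apply y)

theorem continuous_touchingEnergy (Δ : Finset (Site d)) :
    Continuous fun p : (Edge d → ℝ) × Config d => touchingEnergy Δ p.1 p.2 :=
  continuous_finsetSum _ fun e _ => ((continuous_apply e).comp continuous_fst).mul
    ((continuous_spinProduct e).comp continuous_snd)

theorem continuous_glue (Δ : Finset (Site d)) (σ : Δ → ℝ) :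
    Continuous fun ξ : Config d => glue Δ ξ σ := by
  refine continuous_pi fun x => ?_
  by_cases h : x ∈ Δ
  · simpa [glue, h] using continuous_const
  · simpa [glue, h] using continuous_apply x

/-- The energy is dominated locally uniformly in the intensities and the boundary condition. -/
theorem exists_touchingEnergy_glue_le {q : ℝ} (hq : 1 < q) (Δ : Finset (Site d)) :
    ∃ B : (Edge d → ℝ) × Config d → ℝ, Continuous B ∧ ∃ K : ℝ, 0 ≤ K ∧
      ∀ J ξ (σ : Δ → ℝ), touchingEnergy Δ J (glue Δ ξ σ) ≤
        B (J, ξ) + K * ∑ x, |σ x| ^ spinExponent q := by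
  have hp0 : 0 ≤ spinExponent q := by linarith [two_le_spinExponent hq]
  obtain ⟨C, hC, hyoung⟩ := exists_abs_mul_mul_le hq one_pos
  have hglue : ∀ (ξ : Config d) (σ : Δ → ℝ) (a : Site d), |glue Δ ξ σ a| ^ spinExponent q ≤
      |ξ a| ^ spinExponent q + ∑ x, |σ x| ^ spinExponent q := fun ξ σ a => by
    have hS : 0 ≤ ∑ x, |σ x| ^ spinExponent q :=
      Finset.sum_nonneg fun x _ => Real.rpow_nonneg (abs_nonneg _) _
    by_cases h : a ∈ Δ
    · rw [glue_apply_of_mem ξ σ h]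
      have h2 : |σ ⟨a, h⟩| ^ spinExponent q ≤ ∑ x, |σ x| ^ spinExponent q :=
        Finset.single_le_sum (f := fun x => |σ x| ^ spinExponent q)
          (fun x _ => Real.rpow_nonneg (abs_nonneg _) _) (Finset.mem_univ _)
      linarith [Real.rpow_nonneg (abs_nonneg (ξ a)) (spinExponent q)]
    · rw [glue_apply_of_notMem ξ σ h]
      linarith
  have hedge : ∀ e : Edge d, ∃ B : (Edge d → ℝ) × Config d → ℝ, Continuous B ∧
      ∀ J ξ (σ : Δ → ℝ), J e * spinProduct (glue Δ ξ σ) e ≤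
        B (J, ξ) + 2 * ∑ x, |σ x| ^ spinExponent q := fun e => by
    obtain ⟨e, he⟩ := e
    induction e using Sym2.ind with
    | _ a b =>
      refine ⟨fun p => C * |p.1 ⟨s(a, b), he⟩| ^ q +
        (|p.2 a| ^ spinExponent q + |p.2 b| ^ spinExponent q), ?_, fun J ξ σ => ?_⟩
      · have hrpow : ∀ {r : ℝ}, 0 ≤ r → Continuous fun t : ℝ => |t| ^ r := fun hr =>
          continuous_abs.rpow_const fun _ => Or.inr hr
        exact (((hrpow (by linarith : 0 ≤ q)).comp
          ((continuous_apply _).comp continuous_fst)).const_mul C).add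
          (((hrpow hp0).comp ((continuous_apply a).comp continuous_snd)).add
            ((hrpow hp0).comp ((continuous_apply b).comp continuous_snd)))
      · have h1 := hyoung (J ⟨s(a, b), he⟩) (glue Δ ξ σ a) (glue Δ ξ σ b)
        have h2 := le_abs_self (J ⟨s(a, b), he⟩ * glue Δ ξ σ a * glue Δ ξ σ b)
        have h3 : J ⟨s(a, b), he⟩ * spinProduct (glue Δ ξ σ) ⟨s(a, b), he⟩ =
          J ⟨s(a, b), he⟩ * glue Δ ξ σ a * glue Δ ξ σ b := by rw [mul_assoc]; rfl
        rw [h3]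
        linarith [hglue ξ σ a, hglue ξ σ b]
  choose B hBc hB using hedge
  refine ⟨fun p => ∑ e ∈ edgesTouching Δ, B e p, continuous_finsetSum _ fun e _ => hBc e,
    (edgesTouching Δ).card * 2, by positivity, fun J ξ σ => ?_⟩
  refine (Finset.sum_le_sum fun e _ => hB e J ξ σ).trans ?_
  rw [Finset.sum_add_distrib, Finset.sum_const, nsmul_eq_mul, mul_assoc]

/-- Dominated convergence: near `p₀` the bound `B` exceeds `B p₀` by less than 1, and the remaining
dependence on the spins has finite exponential moments. Sites and edges are countable, so
neighbourhood filters are countably generated. -/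
theorem continuous_spinIntegral_boltzmann_mul {q : ℝ} (hq : 1 < q)
    {χ : Site d → ProbabilityMeasure ℝ} (hχ : SingleSpinClass q χ) (Δ : Finset (Site d))
    (f : Config d →ᵇ ℝ≥0) :
    Continuous fun p : (Edge d → ℝ) × Config d =>
      spinIntegral χ Δ (fun η => boltzmann Δ p.1 η * f η) p.2 := by
  obtain ⟨B, hBc, K, hK, hB⟩ := exists_touchingEnergy_glue_le hq Δ
  obtain ⟨M, hM⟩ : ∃ M : ℝ≥0, ∀ η, f η ≤ M := ⟨nndist f 0, fun η => by
    simpa using BoundedContinuousFunction.NNReal.upper_bound f η⟩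
  refine continuous_iff_continuousAt.2 fun p₀ => ?_
  unfold ContinuousAt spinIntegral
  refine tendsto_lintegral_filter_of_dominated_convergence
    (fun σ => ENNReal.ofReal (Real.exp ((B p₀ + 1) + K * ∑ x, |σ x| ^ spinExponent q)) * M)
    (Eventually.of_forall fun p => ?_) ?_ ?_ (ae_of_all _ fun σ => ?_)
  · have hfm : Measurable fun η => (f η : ℝ≥0∞) :=
      f.continuous.measurable.coe_nnreal_ennreal
    exact ((measurable_boltzmann Δ p.1).mul hfm).comp (measurable_glue Δ p.2)
  · have hev : ∀ᶠ p in 𝓝 p₀, B p < B p₀ + 1 :=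
      hBc.continuousAt.eventually (gt_mem_nhds (lt_add_one _))
    filter_upwards [hev] with p hp
    refine ae_of_all _ fun σ => ?_
    refine mul_le_mul' (ENNReal.ofReal_le_ofReal (Real.exp_le_exp.2 ?_)) (by exact_mod_cast hM _)
    exact (hB p.1 p.2 σ).trans (by simpa using hp.le)
  · rw [lintegral_mul_const _ (by fun_prop)]
    exact ENNReal.mul_ne_top (lintegral_exp_lt_top_of_dominated hχ _ hK).ne ENNReal.coe_ne_top
  · have hg : Continuous fun p : (Edge d → ℝ) × Config d => glue Δ p.2 σ :=
      (continuous_glue Δ σ).comp continuous_snd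
    have h1 : Continuous fun p : (Edge d → ℝ) × Config d =>
        boltzmann Δ p.1 (glue Δ p.2 σ) :=
      ENNReal.continuous_ofReal.comp (Real.continuous_exp.comp
        ((continuous_touchingEnergy Δ).comp (continuous_fst.prodMk hg)))
    have h2 : Continuous fun p : (Edge d → ℝ) × Config d => (f (glue Δ p.2 σ) : ℝ≥0∞) :=
      ENNReal.continuous_coe.comp (f.continuous.comp hg)
    exact ENNReal.Tendsto.mul h1.continuousAt (Or.inr ENNReal.coe_ne_top) h2.continuousAt
      (Or.inr ENNReal.ofReal_ne_top)

/-- The integrals of bounded continuous functions with respect to `π_Δ(· | J, ξ)` depend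
continuously on `(J, ξ)`. -/
theorem continuous_lintegral_kernelMeasure {q : ℝ} (hq : 1 < q)
    {χ : Site d → ProbabilityMeasure ℝ} (hχ : SingleSpinClass q χ) (Δ : Finset (Site d))
    (f : Config d →ᵇ ℝ≥0) :
    Continuous fun p : (Edge d → ℝ) × Config d => ∫⁻ η, f η ∂kernelMeasure χ Δ p.1 p.2 := by
  have hfm : Measurable fun η => (f η : ℝ≥0∞) := f.continuous.measurable.coe_nnreal_ennreal
  have hZ := continuous_spinIntegral_boltzmann_mul hq hχ Δ 1
  simp only [BoundedContinuousFunction.coe_one, Pi.one_apply, ENNReal.coe_one, mul_one] at hZ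
  have hN := continuous_spinIntegral_boltzmann_mul hq hχ Δ f
  refine continuous_iff_continuousAt.2 fun p => ?_
  simp only [lintegral_kernelMeasure χ Δ _ _ hfm, partitionFunction_eq_spinIntegral]
  have h0 : spinIntegral χ Δ (boltzmann Δ p.1) p.2 ≠ 0 := by
    rw [← partitionFunction_eq_spinIntegral]; exact partitionFunction_ne_zero χ Δ p.1 p.2
  have hfin : spinIntegral χ Δ (fun η => boltzmann Δ p.1 η * f η) p.2 ≠ ∞ := by
    obtain ⟨M, hM⟩ : ∃ M : ℝ≥0, ∀ η, f η ≤ M := ⟨nndist f 0, fun η => by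
      simpa using BoundedContinuousFunction.NNReal.upper_bound f η⟩
    refine ne_top_of_le_ne_top (ENNReal.mul_ne_top
      (partitionFunction_ne_top hq hχ Δ p.1 p.2) (ENNReal.coe_ne_top (r := M))) ?_
    rw [partitionFunction_eq_spinIntegral]
    unfold spinIntegral
    rw [← lintegral_mul_const _ (show Measurable fun σ => boltzmann Δ p.1 (glue Δ p.2 σ) from
      (measurable_boltzmann Δ p.1).comp (measurable_glue Δ p.2))]
    refine lintegral_mono fun σ => ?_
    exact mul_le_mul' le_rfl (ENNReal.coe_le_coe.2 (hM _))
  exact ENNReal.Tendsto.mul (tendsto_inv_iff.2 hZ.continuousAt) (Or.inr hfin)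
    hN.continuousAt (Or.inr (ENNReal.inv_ne_top.2 h0))

section Kernel

variable {w : Weight d} {q : ℝ} [hq : Fact (1 < q)]

/-- One term of the sum defining the norm bounds `|J e|`. Hence continuity for the product topology
on intensities carries over to the norm topology of `𝒥_q`. -/
theorem continuous_interaction_val : Continuous fun J : Interaction w q => J.val := by
  have h0 : (0 : ℝ) < q := lt_trans one_pos hq.out
  refine continuous_pi fun e => ?_
  let φ : Interaction w q →+ ℝ :=
    { toFun := fun J => J.val e, map_zero' := rfl, map_add' := fun _ _ => rfl }
  have hw : 0 < w.edge e ^ (1 / q) := Real.rpow_pos_of_pos (w.edge_pos e) _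
  refine AddMonoidHomClass.continuous_of_bound φ (w.edge e ^ (1 / q))⁻¹ fun J => ?_
  rw [← div_eq_inv_mul, le_div_iff₀ hw, norm_interaction]
  have hnn : ∀ e, 0 ≤ |J.val e| ^ q * w.edge e := fun e =>
    mul_nonneg (Real.rpow_nonneg (abs_nonneg _) _) (w.edge_pos e).le
  have h1 : |J.val e| ^ q * w.edge e ≤ ∑' e, |J.val e| ^ q * w.edge e :=
    J.2.le_tsum e fun j _ => hnn j
  have h2 := Real.rpow_le_rpow (hnn e) h1 (one_div_nonneg.2 h0.le)
  refine le_trans (le_of_eq ?_) h2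
  rw [Real.mul_rpow (Real.rpow_nonneg (abs_nonneg _) _) (w.edge_pos e).le,
    ← Real.rpow_mul (abs_nonneg _), mul_one_div_cancel h0.ne', Real.rpow_one]
  rfl

theorem lintegral_averageMeasure {Ω : Type*} [MeasurableSpace Ω] (m : ℕ → ProbabilityMeasure Ω)
    (N : ℕ) (f : Ω → ℝ≥0∞) :
    ∫⁻ ω, f ω ∂averageMeasure m N =
      (N : ℝ≥0∞)⁻¹ * ∑ n ∈ Finset.range N, ∫⁻ ω, f ω ∂(m n : Measure Ω) := by
  rw [averageMeasure, lintegral_smul_measure, lintegral_finsetSum_measure, smul_eq_mul]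

theorem lintegral_averagedKernel {χ : Site d → ProbabilityMeasure ℝ} (hχ : SingleSpinClass q χ)
    (D : ℕ → Finset (Site d)) (N : ℕ+) (J : Interaction w q) (ξ : Config d)
    (f : Config d → ℝ≥0∞) :
    ∫⁻ η, f η ∂(averagedKernel hχ D N J ξ : Measure (Config d)) =
      ((N : ℕ) : ℝ≥0∞)⁻¹ *
        ∑ n ∈ Finset.range N, ∫⁻ η, f η ∂kernelMeasure χ (D n) J.val ξ :=
  lintegral_averageMeasure _ N f

theorem continuous_averagedKernel {χ : Site d → ProbabilityMeasure ℝ} (hχ : SingleSpinClass q χ)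
    (D : ℕ → Finset (Site d)) (N : ℕ+) (ξ : Config d) :
    Continuous fun J : Interaction w q => averagedKernel hχ D N J ξ := by
  have hc : Continuous fun J : Interaction w q => (J.val, ξ) :=
    Continuous.prodMk continuous_interaction_val continuous_const
  have h1 : ∀ (f : Config d →ᵇ ℝ≥0) (n : ℕ), Continuous fun J : Interaction w q =>
      ∫⁻ η, f η ∂kernelMeasure χ (D n) J.val ξ := fun f n => by
    have h2 := continuous_lintegral_kernelMeasure hq.out hχ (D n) f
    have h3 := h2.comp hc
    exact h3
  have hN : ((N : ℕ) : ℝ≥0∞)⁻¹ ≠ ∞ := ENNReal.inv_ne_top.2 (by exact_mod_cast N.ne_zero)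
  have h2 : ∀ f : Config d →ᵇ ℝ≥0, Continuous fun J : Interaction w q =>
      ((N : ℕ) : ℝ≥0∞)⁻¹ *
        ∑ n ∈ Finset.range N, ∫⁻ η, f η ∂kernelMeasure χ (D n) J.val ξ := fun f =>
    (ENNReal.continuous_const_mul hN).comp (continuous_finsetSum _ fun n _ => h1 f n)
  refine continuous_iff_continuousAt.2 fun J => ?_
  refine ProbabilityMeasure.tendsto_iff_forall_lintegral_tendsto.2 fun f => ?_
  simp only [lintegral_averagedKernel]
  exact (h2 f).continuousAt

end Kernel

/-! ### Tightness and temperedness of limits -/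

/-- The functional `∑_x w(x) |σ(x)|^p` with values in `[0, ∞]`. -/
noncomputable def weightedEnergy (w : Weight d) (p : ℝ) (σ : Config d) : ℝ≥0∞ :=
  ∑' x, ENNReal.ofReal (w x) * ENNReal.ofReal (|σ x| ^ p)

theorem measurable_weightedEnergy (w : Weight d) (p : ℝ) : Measurable (weightedEnergy w p) :=
  Measurable.tsum fun x => by fun_prop

theorem lowerSemicontinuous_weightedEnergy (w : Weight d) {p : ℝ} (hp : 0 ≤ p) :
    LowerSemicontinuous (weightedEnergy w p) := by
  refine lowerSemicontinuous_tsum fun x => Continuous.lowerSemicontinuous ?_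
  refine (ENNReal.continuous_const_mul ENNReal.ofReal_ne_top).comp
    (ENNReal.continuous_ofReal.comp ?_)
  exact (continuous_abs.comp (continuous_apply x)).rpow_const fun _ => Or.inr hp

theorem mem_temperedConfigs_of_weightedEnergy_ne_top {w : Weight d} {p : ℝ} {σ : Config d}
    (h : weightedEnergy w p σ ≠ ∞) : σ ∈ temperedConfigs w p := by
  have h1 := ENNReal.summable_toReal h
  refine h1.congr fun x => ?_
  rw [ENNReal.toReal_mul, ENNReal.toReal_ofReal (w.pos x).le,
    ENNReal.toReal_ofReal (Real.rpow_nonneg (abs_nonneg _) _), mul_comm]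

/-- The sublevel sets of the weighted energy are contained in compact sets. -/
theorem exists_isCompact_compl_subset (w : Weight d) {p : ℝ} (hp : 0 < p) (n : ℕ) :
    ∃ K : Set (Config d), IsCompact K ∧ Kᶜ ⊆ {σ | (n : ℝ≥0∞) ≤ weightedEnergy w p σ} := by
  -- Leaving the interval at a single site `x` already makes the term `w(x) |σ(x)|^p` at least `n`.
  set r : Site d → ℝ := fun x => (n / w x) ^ (1 / p) with hr
  refine ⟨Set.pi Set.univ fun x => Set.Icc (-r x) (r x),
    isCompact_univ_pi fun x => isCompact_Icc, fun σ hσ => ?_⟩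
  simp only [Set.mem_compl_iff, Set.mem_pi, Set.mem_univ, true_implies, not_forall,
    Set.mem_Icc, ← abs_le, not_le] at hσ
  obtain ⟨x, hx⟩ := hσ
  have hn0 : (0 : ℝ) ≤ n / w x := div_nonneg n.cast_nonneg (w.pos x).le
  have h1 : (n : ℝ) / w x ≤ |σ x| ^ p := by
    have h2 := Real.rpow_le_rpow (Real.rpow_nonneg hn0 _) hx.le hp.le
    rwa [← Real.rpow_mul hn0, one_div_mul_cancel hp.ne', Real.rpow_one] at h2
  rw [div_le_iff₀ (w.pos x)] at h1
  calc (n : ℝ≥0∞) = ENNReal.ofReal n := (ENNReal.ofReal_natCast n).symm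
    _ ≤ ENNReal.ofReal (w x) * ENNReal.ofReal (|σ x| ^ p) := by
        rw [← ENNReal.ofReal_mul (w.pos x).le, mul_comm]
        exact ENNReal.ofReal_le_ofReal h1
    _ ≤ weightedEnergy w p σ :=
        ENNReal.le_tsum (f := fun x => ENNReal.ofReal (w x) * ENNReal.ofReal (|σ x| ^ p)) x

/-- Markov's inequality outside the compact boxes gives tightness; Prokhorov's theorem does the
rest. -/
theorem isCompact_closure_of_lintegral_weightedEnergy_le (w : Weight d) {p : ℝ} (hp : 0 < p)
    {S : Set (ProbabilityMeasure (Config d))} {K : ℝ≥0∞} (hK : K ≠ ∞)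
    (h : ∀ μ ∈ S, ∫⁻ σ, weightedEnergy w p σ ∂(μ : Measure (Config d)) ≤ K) :
    IsCompact (closure S) := by
  refine isCompact_closure_of_isTightMeasureSet
    (isTightMeasureSet_iff_exists_isCompact_measure_compl_le.2 fun ε hε => ?_)
  obtain ⟨n, hn⟩ := ENNReal.exists_nat_mul_gt hε.ne' hK
  have hn0 : n ≠ 0 := by
    rintro rfl
    simp at hn
  obtain ⟨C, hC, hsub⟩ := exists_isCompact_compl_subset w hp n
  refine ⟨C, hC, ?_⟩
  rintro _ ⟨μ, hμ, rfl⟩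
  refine (measure_mono hsub).trans ?_
  refine (meas_ge_le_lintegral_div (measurable_weightedEnergy w p).aemeasurable
    (by exact_mod_cast hn0) (ENNReal.natCast_ne_top n)).trans ?_
  refine ENNReal.div_le_of_le_mul ((h μ hμ).trans ?_)
  rw [mul_comm]
  exact hn.le

/-- Lower semicontinuity makes the strict superlevel sets of the energy open, so the Markov bounds
`K / n` survive the weak limit by the portmanteau theorem. Letting `n` grow, the energy is finite
almost surely. -/
theorem measure_temperedConfigs_eq_one_of_tendsto {w : Weight d} {p : ℝ} (hp : 0 ≤ p)
    {ι : Type*} {L : Filter ι} [L.NeBot] {μs : ι → ProbabilityMeasure (Config d)}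
    {μ : ProbabilityMeasure (Config d)} (hμ : Tendsto μs L (𝓝 μ)) {K : ℝ≥0∞} (hK : K ≠ ∞)
    (h : ∀ i, ∫⁻ σ, weightedEnergy w p σ ∂(μs i : Measure (Config d)) ≤ K) :
    (μ : Measure (Config d)) (temperedConfigs w p) = 1 := by
  have hbound : ∀ n : ℕ, n ≠ 0 →
      (μ : Measure (Config d)) {σ | (n : ℝ≥0∞) < weightedEnergy w p σ} ≤ K / n := fun n hn => by
    have hopen : IsOpen {σ : Config d | (n : ℝ≥0∞) < weightedEnergy w p σ} :=
      (lowerSemicontinuous_weightedEnergy w hp).isOpen_preimage _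
    refine (ProbabilityMeasure.le_liminf_measure_open_of_tendsto hμ hopen).trans ?_
    refine liminf_le_of_le (by isBoundedDefault) fun b hb => ?_
    obtain ⟨i, hi⟩ := hb.exists
    refine hi.trans ?_
    refine (measure_mono (t := {σ | (n : ℝ≥0∞) ≤ weightedEnergy w p σ})
      fun σ hσ => le_of_lt (by simpa using hσ)).trans ?_
    refine (meas_ge_le_lintegral_div (measurable_weightedEnergy w p).aemeasurable
      (by exact_mod_cast hn) (ENNReal.natCast_ne_top n)).trans ?_
    exact ENNReal.div_le_div_right (h i) _
  have hzero : (μ : Measure (Config d)) {σ | weightedEnergy w p σ = ∞} = 0 := by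
    refine le_antisymm (ENNReal.le_of_forall_pos_le_add fun ε hε _ => ?_) zero_le
    obtain ⟨n, hn⟩ := ENNReal.exists_nat_mul_gt (a := (ε : ℝ≥0∞)) (by exact_mod_cast hε.ne') hK
    have hn0 : n ≠ 0 := by
      rintro rfl
      simp at hn
    rw [zero_add]
    refine le_trans (measure_mono fun σ hσ => ?_) ((hbound n hn0).trans
      (ENNReal.div_le_of_le_mul (by rw [mul_comm]; exact hn.le)))
    rw [Set.mem_ofPred_eq] at hσ ⊢
    rw [hσ]
    exact ENNReal.natCast_lt_top n
  have hae : ∀ᵐ σ ∂(μ : Measure (Config d)), σ ∈ temperedConfigs w p := by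
    have : ∀ᵐ σ ∂(μ : Measure (Config d)), weightedEnergy w p σ ≠ ∞ := by
      rw [ae_iff]; simpa using hzero
    exact this.mono fun σ hσ => mem_temperedConfigs_of_weightedEnergy_ne_top hσ
  exact (measure_congr (eventuallyEq_univ.2 hae)).trans measure_univ

/-! ### Limits of averaged kernels -/

section Gibbs

variable {w : Weight d} {q : ℝ} [hq : Fact (1 < q)] {χ : Site d → ProbabilityMeasure ℝ}

theorem exists_lintegral_weightedEnergy_averagedKernel_le (hχ : SingleSpinClass q χ)
    (J : Interaction w q) {ξ : Config d} (hξ : ξ ∈ temperedConfigs w (spinExponent q)) :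
    ∃ K : ℝ≥0∞, K ≠ ∞ ∧ ∀ (D : ℕ → Finset (Site d)) (N : ℕ+),
      ∫⁻ σ, weightedEnergy w (spinExponent q) σ
        ∂(averagedKernel hχ D N J ξ : Measure (Config d)) ≤ K := by
  obtain ⟨K, hK, hle⟩ := exists_tsum_moment_kernelMeasure_le hχ J hξ
  refine ⟨K, hK, fun D N => ?_⟩
  have h1 : ∀ n, ∫⁻ σ, weightedEnergy w (spinExponent q) σ ∂kernelMeasure χ (D n) J.val ξ ≤ K :=
    fun n => by
      unfold weightedEnergy
      rw [lintegral_tsum fun x => Measurable.aemeasurable (by fun_prop)]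
      refine le_trans (le_of_eq (tsum_congr fun x => ?_)) (hle (D n))
      exact lintegral_const_mul _ (by fun_prop)
  rw [lintegral_averagedKernel]
  have hN0 : ((N : ℕ) : ℝ≥0∞) ≠ 0 := by exact_mod_cast N.ne_zero
  calc _ ≤ ((N : ℕ) : ℝ≥0∞)⁻¹ * ∑ n ∈ Finset.range N, K := by
        gcongr with n _; exact h1 n
    _ = K := by
        rw [Finset.sum_const, Finset.card_range, nsmul_eq_mul, ← mul_assoc,
          ENNReal.inv_mul_cancel hN0 (ENNReal.natCast_ne_top _), one_mul]

theorem lintegral_kernelMeasure_le (hχ : SingleSpinClass q χ) (Δ : Finset (Site d))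
    (J : Edge d → ℝ) (ξ : Config d) {f : Config d → ℝ≥0} {M : ℝ≥0} (hM : ∀ η, f η ≤ M) :
    ∫⁻ η, f η ∂kernelMeasure χ Δ J ξ ≤ M := by
  have := isProbabilityMeasure_kernelMeasure hq.out hχ Δ J ξ
  calc _ ≤ ∫⁻ _, (M : ℝ≥0∞) ∂kernelMeasure χ Δ J ξ :=
        lintegral_mono fun η => ENNReal.coe_le_coe.2 (hM η)
    _ = M := by simp

/-- The bounded continuous function `ξ ↦ ∫ f dπ_Δ(· | J, ξ)`. -/
theorem exists_boundedContinuous_lintegral_kernelMeasure (hχ : SingleSpinClass q χ)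
    (Δ : Finset (Site d)) (J : Edge d → ℝ) (f : Config d →ᵇ ℝ≥0) :
    ∃ F : Config d →ᵇ ℝ≥0, ∀ ξ, (F ξ : ℝ≥0∞) = ∫⁻ η, f η ∂kernelMeasure χ Δ J ξ := by
  have hM : ∀ η, f η ≤ nndist f 0 := fun η => by
    simpa using BoundedContinuousFunction.NNReal.upper_bound f η
  have hle : ∀ ξ, ∫⁻ η, f η ∂kernelMeasure χ Δ J ξ ≤ (nndist f 0 : ℝ≥0) := fun ξ =>
    lintegral_kernelMeasure_le hχ Δ J ξ hM
  have hfin : ∀ ξ, ∫⁻ η, f η ∂kernelMeasure χ Δ J ξ ≠ ∞ := fun ξ =>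
    ne_top_of_le_ne_top ENNReal.coe_ne_top (hle ξ)
  have hc : Continuous fun ξ : Config d => (J, ξ) := Continuous.prodMk continuous_const continuous_id
  have hcont : Continuous fun ξ : Config d => ∫⁻ η, f η ∂kernelMeasure χ Δ J ξ := by
    have h2 := continuous_lintegral_kernelMeasure hq.out hχ Δ f
    have h3 := h2.comp hc
    exact h3
  refine ⟨BoundedContinuousFunction.mkOfBound
    ⟨fun ξ => (∫⁻ η, f η ∂kernelMeasure χ Δ J ξ).toNNReal,
      continuous_iff_continuousAt.2 fun ξ =>
        (ENNReal.tendsto_toNNReal (hfin ξ)).comp hcont.continuousAt⟩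
    (nndist f 0) fun ξ η => ?_, fun ξ => ENNReal.coe_toNNReal (hfin ξ)⟩
  have h4 : ∀ ξ, (∫⁻ η, f η ∂kernelMeasure χ Δ J ξ).toNNReal ≤ nndist f 0 := fun ξ =>
    ENNReal.toNNReal_mono ENNReal.coe_ne_top (hle ξ)
  have h5 := NNReal.coe_le_coe.2 (h4 ξ)
  have h6 := NNReal.coe_le_coe.2 (h4 η)
  simp only [ContinuousMap.coe_mk, NNReal.dist_eq]
  rw [abs_le]
  constructor <;>
    linarith [NNReal.coe_nonneg (∫⁻ η, f η ∂kernelMeasure χ Δ J ξ).toNNReal,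
      NNReal.coe_nonneg (∫⁻ ζ, f ζ ∂kernelMeasure χ Δ J η).toNNReal]

theorem toReal_lintegral_averagedKernel (hχ : SingleSpinClass q χ) (D : ℕ → Finset (Site d))
    (N : ℕ+) (J : Interaction w q) (ξ : Config d) {f : Config d → ℝ≥0} {M : ℝ≥0}
    (hM : ∀ η, f η ≤ M) :
    (∫⁻ η, f η ∂(averagedKernel hχ D N J ξ : Measure (Config d))).toReal =
      (∑ n ∈ Finset.range N, (∫⁻ η, f η ∂kernelMeasure χ (D n) J.val ξ).toReal) / (N : ℕ) := by
  rw [lintegral_averagedKernel, ENNReal.toReal_mul, ENNReal.toReal_inv, ENNReal.toReal_natCast,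
    ENNReal.toReal_sum fun n _ => ne_top_of_le_ne_top ENNReal.coe_ne_top
      (lintegral_kernelMeasure_le hχ (D n) J.val ξ hM), div_eq_inv_mul]

/-- Limits of averaged kernels satisfy the Dobrushin-Lanford-Ruelle equation for bounded continuous
functions. -/
theorem lintegral_lintegral_kernelMeasure_of_tendsto (hχ : SingleSpinClass q χ)
    {D : ℕ → Finset (Site d)} (hD : IsCofinalSequence D) (J : Interaction w q) (ξ : Config d)
    {μ : ProbabilityMeasure (Config d)}
    (hμ : Tendsto (fun N : ℕ+ => averagedKernel hχ D N J ξ) atTop (𝓝 μ))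
    (Δ : Finset (Site d)) (f : Config d →ᵇ ℝ≥0) :
    ∫⁻ σ, ∫⁻ η, f η ∂kernelMeasure χ Δ J.val σ ∂(μ : Measure (Config d)) =
      ∫⁻ η, f η ∂(μ : Measure (Config d)) := by
  obtain ⟨F, hF⟩ := exists_boundedContinuous_lintegral_kernelMeasure hχ Δ J.val f
  simp_rw [← hF]
  have hub : ∀ (g : Config d →ᵇ ℝ≥0) η, g η ≤ nndist g 0 := fun g η => by
    simpa using BoundedContinuousFunction.NNReal.upper_bound g η
  have hfin : ∀ g : Config d →ᵇ ℝ≥0, ∫⁻ η, g η ∂(μ : Measure (Config d)) ≠ ∞ := fun g =>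
    (BoundedContinuousFunction.lintegral_lt_top_of_nnreal (μ : Measure (Config d)) g).ne
  have hlim : ∀ g : Config d →ᵇ ℝ≥0, Tendsto (fun N : ℕ+ =>
      (∑ n ∈ Finset.range N, (∫⁻ η, g η ∂kernelMeasure χ (D n) J.val ξ).toReal) / (N : ℕ)) atTop
      (𝓝 (∫⁻ η, g η ∂(μ : Measure (Config d))).toReal) := fun g => by
    have h1 := ProbabilityMeasure.tendsto_iff_forall_lintegral_tendsto.1 hμ g
    have h2 := (ENNReal.tendsto_toReal (hfin g)).comp h1
    refine h2.congr fun N => ?_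
    exact toReal_lintegral_averagedKernel hχ D N J ξ (hub g)
  have hev : ∀ᶠ n in atTop, Δ ⊆ D n := by
    have h1 : ∀ᶠ n in atTop, ∀ x ∈ Δ, x ∈ D n := by
      rw [eventually_all_finset]
      intro x _
      obtain ⟨m, hm⟩ := hD.exhausting x
      filter_upwards [eventually_ge_atTop m] with n hn
      exact hD.strictMono.monotone hn hm
    exact h1
  -- The defect in the equilibrium equation at the `n`-th volume vanishes once `D n` contains `Δ`,
  -- so its Cesàro means tend to 0.
  set u : ℕ → ℝ := fun n => (∫⁻ η, F η ∂kernelMeasure χ (D n) J.val ξ).toReal -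
    (∫⁻ η, f η ∂kernelMeasure χ (D n) J.val ξ).toReal with hu
  have hu0 : Tendsto u atTop (𝓝 0) := by
    refine tendsto_const_nhds.congr' ?_
    filter_upwards [hev] with n hn
    simp only [hu, hF]
    rw [lintegral_lintegral_kernelMeasure hq.out hχ hn J.val ξ
      f.continuous.measurable.coe_nnreal_ennreal, sub_self]
  have hces := hu0.cesaro.comp tendsto_PNat_val_atTop_atTop
  have hdiff := (hlim F).sub (hlim f)
  have heq := tendsto_nhds_unique hdiff (hces.congr fun N => by
    simp only [hu, Function.comp_apply, Finset.sum_sub_distrib]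
    ring)
  exact (ENNReal.toReal_eq_toReal_iff' (hfin F) (hfin f)).1 (sub_eq_zero.1 heq)

/-- Limits of averaged kernels along a cofinal sequence are tempered Gibbs measures. -/
theorem mem_gibbsMeasures_of_tendsto (hχ : SingleSpinClass q χ)
    {D : ℕ → Finset (Site d)} (hD : IsCofinalSequence D) (J : Interaction w q) {ξ : Config d}
    (hξ : ξ ∈ temperedConfigs w (spinExponent q)) {μ : ProbabilityMeasure (Config d)}
    (hμ : Tendsto (fun N : ℕ+ => averagedKernel hχ D N J ξ) atTop (𝓝 μ)) :
    μ ∈ gibbsMeasures hχ J := by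
  have hp0 : 0 ≤ spinExponent q := by linarith [two_le_spinExponent hq.out]
  obtain ⟨K, hK, hle⟩ := exists_lintegral_weightedEnergy_averagedKernel_le hχ J hξ
  refine ⟨measure_temperedConfigs_eq_one_of_tendsto hp0 hμ hK (hle D), fun Δ _ A hA => ?_⟩
  have hkm : Measurable fun σ : Config d => kernelMeasure χ Δ J.val σ := by
    refine Measure.measurable_of_measurable_coe _ fun s hs => ?_
    have := measurable_lintegral_kernelMeasure χ Δ J.val
      (f := s.indicator 1) (measurable_one.indicator hs)
    simpa only [lintegral_indicator_one hs] using this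
  -- Finite Borel measures here are determined by bounded continuous functions, which extends the
  -- equation from such functions to all Borel sets.
  have hbind : (μ : Measure (Config d)) =
      (μ : Measure (Config d)).bind fun σ => kernelMeasure χ Δ J.val σ := by
    refine ext_of_forall_lintegral_eq_of_IsFiniteMeasure fun f => ?_
    rw [Measure.lintegral_bind hkm.aemeasurable
      f.continuous.measurable.coe_nnreal_ennreal.aemeasurable]
    exact (lintegral_lintegral_kernelMeasure_of_tendsto hχ hD J ξ hμ Δ f).symm
  conv_rhs => rw [hbind, Measure.bind_apply hA hkm.aemeasurable]
  rfl

/-- If the averages of a separating family of functions converge, then so do the averaged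
kernels. -/
theorem exists_tendsto_averagedKernel (hχ : SingleSpinClass q χ) (D : ℕ → Finset (Site d))
    (J : Interaction w q) {ξ : Config d} (hξ : ξ ∈ temperedConfigs w (spinExponent q))
    (g : ℕ → Config d →ᵇ ℝ≥0) (hg1 : ∀ k η, g k η ≤ 1)
    (hg : ∀ μ ν : ProbabilityMeasure (Config d), (∀ k, ∫⁻ η, g k η ∂(μ : Measure (Config d)) =
      ∫⁻ η, g k η ∂(ν : Measure (Config d))) → μ = ν)
    (hlim : ∀ k, ∃ l, Tendsto (fun N : ℕ => (∑ n ∈ Finset.range N,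
      (∫⁻ η, g k η ∂kernelMeasure χ (D n) J.val ξ).toReal) / N) atTop (𝓝 l)) :
    ∃ μ, Tendsto (fun N : ℕ+ => averagedKernel hχ D N J ξ) atTop (𝓝 μ) := by
  have hp0 : 0 < spinExponent q := by linarith [two_le_spinExponent hq.out]
  obtain ⟨K, hK, hle⟩ := exists_lintegral_weightedEnergy_averagedKernel_le hχ J hξ
  have hcomp := isCompact_closure_of_lintegral_weightedEnergy_le w hp0 hK
    (S := Set.range fun N : ℕ+ => averagedKernel hχ D N J ξ) (by
      rintro _ ⟨N, rfl⟩
      exact hle D N)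
  have hmem : ∀ N : ℕ+, averagedKernel hχ D N J ξ ∈
      closure (Set.range fun N : ℕ+ => averagedKernel hχ D N J ξ) := fun N =>
    subset_closure ⟨N, rfl⟩
  choose l hl using hlim
  have hfin : ∀ (μ : ProbabilityMeasure (Config d)) k,
      ∫⁻ η, g k η ∂(μ : Measure (Config d)) ≠ ∞ := fun μ k =>
    (BoundedContinuousFunction.lintegral_lt_top_of_nnreal (μ : Measure (Config d)) (g k)).ne
  -- Every cluster point has the prescribed integrals `l k`, so the separating family admits only
  -- one; in a compact set this yields convergence.
  have hcluster : ∀ μ : ProbabilityMeasure (Config d),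
      MapClusterPt μ atTop (fun N : ℕ+ => averagedKernel hχ D N J ξ) →
      ∀ k, (∫⁻ η, g k η ∂(μ : Measure (Config d))).toReal = l k := fun μ hμ k => by
    have hcont : ContinuousAt (fun μ : ProbabilityMeasure (Config d) =>
        (∫⁻ η, g k η ∂(μ : Measure (Config d))).toReal) μ :=
      (ENNReal.tendsto_toReal (hfin μ k)).comp
        (ProbabilityMeasure.tendsto_iff_forall_lintegral_tendsto.1 tendsto_id (g k))
    have h1 := hμ.continuousAt_comp hcont
    have h2 : Tendsto ((fun μ : ProbabilityMeasure (Config d) =>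
        (∫⁻ η, g k η ∂(μ : Measure (Config d))).toReal) ∘
        fun N : ℕ+ => averagedKernel hχ D N J ξ) atTop (𝓝 (l k)) := by
      refine ((hl k).comp tendsto_PNat_val_atTop_atTop).congr fun N => ?_
      exact (toReal_lintegral_averagedKernel hχ D N J ξ (hg1 k)).symm
    have h3 : ClusterPt (∫⁻ η, g k η ∂(μ : Measure (Config d))).toReal (𝓝 (l k)) :=
      ClusterPt.mono h1 h2
    have : (𝓝 (∫⁻ η, g k η ∂(μ : Measure (Config d))).toReal ⊓ 𝓝 (l k)).NeBot := h3
    exact eq_of_nhds_neBot this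
  obtain ⟨μ, -, hμ⟩ := hcomp.exists_mapClusterPt (f := atTop)
    (u := fun N : ℕ+ => averagedKernel hχ D N J ξ)
    (tendsto_principal.2 (Eventually.of_forall hmem))
  refine ⟨μ, hcomp.tendsto_nhds_of_unique_mapClusterPt (Eventually.of_forall hmem)
    fun μ' _ hμ' => hg _ _ fun k => ?_⟩
  rw [← ENNReal.toReal_eq_toReal_iff' (hfin μ' k) (hfin μ k), hcluster μ' hμ' k, hcluster μ hμ k]

end Gibbs

/-! ### Exhausting boxes and the conclusion -/

/-- The box `[-n, n]^d`. -/
noncomputable def box (d n : ℕ) : Finset (Site d) :=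
  Finset.Icc (fun _ => -(n : ℤ)) (fun _ => (n : ℤ))

theorem isCofinalSequence_box (hd : 1 ≤ d) : IsCofinalSequence (box d) where
  nonempty n := ⟨0, by
    rw [box, Finset.mem_Icc]
    exact ⟨fun _ => by simp, fun _ => by simp⟩⟩
  strictMono := by
    refine strictMono_nat_of_lt_succ fun n => ?_
    rw [Finset.ssubset_iff_of_subset]
    · refine ⟨fun _ => (n + 1 : ℕ), ?_, ?_⟩
      · rw [box, Finset.mem_Icc]
        exact ⟨fun _ => by dsimp only; omega, le_rfl⟩
      · rw [box, Finset.mem_Icc]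
        rintro ⟨-, h⟩
        -- A coordinate to compare exists because `d ≥ 1`; for `d = 0` all boxes coincide.
        have := h ⟨0, hd⟩
        dsimp only at this
        omega
    · refine Finset.Icc_subset_Icc (fun _ => ?_) (fun _ => ?_) <;> dsimp only <;> omega
  exhausting x := by
    refine ⟨∑ i, (x i).natAbs, ?_⟩
    have h : ∀ i, (x i).natAbs ≤ ∑ i, (x i).natAbs := fun i =>
      Finset.single_le_sum (f := fun i => (x i).natAbs) (fun _ _ => Nat.zero_le _)
        (Finset.mem_univ i)
    rw [box, Finset.mem_Icc]
    constructor <;> intro i <;> have := h i <;> dsimp only <;> omega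

theorem IsCofinalSequence.comp {D : ℕ → Finset (Site d)} (hD : IsCofinalSequence D) {φ : ℕ → ℕ}
    (hφ : StrictMono φ) : IsCofinalSequence (D ∘ φ) where
  nonempty n := hD.nonempty _
  strictMono := hD.strictMono.comp hφ
  exhausting x := by
    obtain ⟨m, hm⟩ := hD.exhausting x
    exact ⟨m, hD.strictMono.monotone hφ.le_apply hm⟩

end RandomSpin

theorem theorem3 {d : ℕ} (hd : 1 ≤ d) (w : Weight d) (q : ℝ) [Fact (1 < q)]
    (χ : Site d → ProbabilityMeasure ℝ) (hχ : SingleSpinClass q χ)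
    (ν : Measure (Interaction w q)) [IsProbabilityMeasure ν]
    (ξ : Config d) (hξ : ξ ∈ temperedConfigs w (spinExponent q)) :
    ∃ (μ : Interaction w q → ProbabilityMeasure (Config d)) (D : ℕ → Finset (Site d)),
      IsRandomGibbsMeasure hχ ν μ ∧ IsCofinalSequence D ∧
        ∀ᵐ J ∂ν, Tendsto (fun N : ℕ+ => averagedKernel hχ D N J ξ) atTop (𝓝 (μ J)) := by
  obtain ⟨g, hg1, hg⟩ := exists_seq_boundedContinuous_separating (Config d)
  have hmeas : ∀ k n, Measurable fun J : Interaction w q =>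
      (∫⁻ η, g k η ∂kernelMeasure χ (box d n) J.val ξ).toReal := fun k n => by
    have hc : Continuous fun J : Interaction w q => (J.val, ξ) :=
      Continuous.prodMk continuous_interaction_val continuous_const
    have h2 := continuous_lintegral_kernelMeasure (Fact.out : 1 < q) hχ (box d n) (g k)
    have h3 := h2.comp hc
    exact (show Measurable fun J : Interaction w q =>
      ∫⁻ η, g k η ∂kernelMeasure χ (box d n) J.val ξ from h3.measurable).ennreal_toReal
  -- The intensities now serve as the random parameter: `k` numbers the test functions and `n` the
  -- boxes. The subsequence `φ` is common to all test functions and does not depend on `J`.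
  obtain ⟨φ, hφ, hae⟩ := exists_strictMono_ae_tendsto_average ν _ hmeas fun k n J =>
    ⟨ENNReal.toReal_nonneg, ENNReal.toReal_le_of_le_ofReal zero_le_one (by
      simpa using lintegral_kernelMeasure_le hχ (box d n) J.val ξ (hg1 k))⟩
  have hD : IsCofinalSequence (box d ∘ φ) := (isCofinalSequence_box hd).comp hφ
  have hconv : ∀ᵐ J ∂ν, ∃ μ,
      Tendsto (fun N : ℕ+ => averagedKernel hχ (box d ∘ φ) N J ξ) atTop (𝓝 μ) := by
    filter_upwards [hae] with J hJ
    exact exists_tendsto_averagedKernel hχ (box d ∘ φ) J hξ g hg1 hg hJ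
  obtain ⟨μ, hμm, hμ⟩ := exists_measurable_borel_ae_tendsto ν
    (fun N => continuous_averagedKernel hχ (box d ∘ φ) N ξ) hconv
  refine ⟨μ, box d ∘ φ, ⟨hμm, ?_⟩, hD, hμ⟩
  filter_upwards [hμ] with J hJ
  exact mem_gibbsMeasures_of_tendsto hχ hD J hξ hJ
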